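/- Let $X$ be a finite-dimensional normed space, $X^*$ its dual, and $T>0$. Assume: * $\Psi_0:X\to[0,\infty)$ satisfies $\Psi_0(v)>0$ for $v\ne0$, $\Psi_0(v_1+v_2)\le\Psi_0(v_1)+\Psi_0(v_2)$, and $\Psi_0(\lambda v)=\lambda\Psi_0(v)$ for $\lambda\ge0$; put $K^*=\{w\in X^*:\langle w,z\rangle\le\Psi_0(z)\ \forall z\in X\}$. * $\Psi:X\to[0,\infty)$ is convex, $\Psi(0)=0$, $\Psi(v)/\|v\|\to\infty$ as $\|v\|\to\infty$, and $\Psi_\varepsilon(v):=\varepsilon^{-1}\Psi(\varepsilon v)\to\Psi_0(v)$ as $\varepsilon\downarrow0$ for every $v\in X$. * $\mathcal E\in C^1([0,T]\times X)$ and, for some $C>0$ and all $(t,x)$, $\mathcal E_t(x)\ge -C$ and $|\partial_t\mathcal E_t(x)|\le C(1+\mathcal E_t(x)^+)$. Let $\Psi^*$ be the Legendre conjugate of $\Psi$, let $\mathfrak p(v,w)=\inf_{\varepsilon>0}\big(\varepsilon^{-1}\Psi(\varepsilon v)+\varepsilon^{-1}\Psi^*(w)\big)$ for $v\in X$, $w\in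 X^*$, and for $t\in[0,T]$, $x_0,x_1\in X$ let $$\Delta_{\mathfrak p,\mathcal E}(t;x_0,x_1)=\inf\Big\{\int_{r_0}^{r_1}\mathfrak p\big(\dot\vartheta(r),-\mathrm D\mathcal E_t(\vartheta(r))\big)\,\mathrm dr:\ \vartheta\in AC([r_0,r_1];X),\ \vartheta(r_0)=x_0,\ \vartheta(r_1)=x_1\Big\}.$$ Let $u:[0,T]\to X$ be defined everywhere and of bounded variation, with one-sided limits $u(t_\pm)$ and the conventions $u(0_-)=u(0)$, $u(T_+)=u(T)$, and let $J_u=\{t\in[0,T]:u(t_-)\ne u(t)\text{ or }u(t)\ne u(t_+)\}$. Let $u'=\dot u\,\mathcal L^1+u'_{\rm C}+u'_{\rm J}$ be the decomposition of its distributional derivative on $(0,T)$ into absolutely continuous, Cantor and jump parts, $u'_{\rm co}=\dot u\,\mathcal L^1+u'_{\rm C}$, and $\mu=\mathcal L^1+|u'_{\rm C}|$ on $(0,T)$. For $0\le a<b\le T$ let $$\begin{aligned}\mathrm{Var}_{\mathfrak p,\mathcal E}(u;[a,b])={}&\int_{(a,b)}\Psi_0\Big(\frac{\mathrm du'_{\rm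 co}}{\mathrm d\mu}\Big)\mathrm d\mu+\Delta_{\mathfrak p,\mathcal E}(a;u(a),u(a_+))+\Delta_{\mathfrak p,\mathcal E}(b;u(b_-),u(b))\\&+\sum_{t\in J_u\cap(a,b)}\big(\Delta_{\mathfrak p,\mathcal E}(t;u(t_-),u(t))+\Delta_{\mathfrak p,\mathcal E}(t;u(t),u(t_+))\big)\in[0,\infty],\end{aligned}$$ and let $\mathrm{Var}_{\mathfrak p,\mathcal E}(u;[a,a])=0$. The curve $u$ is called a *BV solution* if $-\mathrm D\mathcal E_t(u(t))\in K^*$ for a.e. $t\in[0,T]\setminus J_u$ and $$\mathrm{Var}_{\mathfrak p,\mathcal E}(u;[0,t])+\mathcal E_t(u(t))=\mathcal E_0(u(0))+\int_0^t\partial_t\mathcal E_s(u(s))\,\mathrm ds\qquad\text{for all }t\in[0,T].$$ **Theorem.** A curve $u$ of bounded variation is a BV solution if and only if both of the following hold: 1. $\displaystyle\partial\Psi_0\Big(\frac{\mathrm du'_{\rm co}}{\mathrm d\mu}(t)\Big)+\mathrm D\mathcal E_t(u(t))\ni0$ for $\mu$-a.e. $t\in(0,T)$; 2. for every $t\in J_u$,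 $$\begin{aligned}\mathcal E_t(u(t))-\mathcal E_t(u(t_-))&=-\Delta_{\mathfrak p,\mathcal E}(t;u(t_-),u(t)),\\ \mathcal E_t(u(t_+))-\mathcal E_t(u(t))&=-\Delta_{\mathfrak p,\mathcal E}(t;u(t),u(t_+)),\\ \mathcal E_t(u(t_+))-\mathcal E_t(u(t_-))&=-\Delta_{\mathfrak p,\mathcal E}(t;u(t_-),u(t_+)).\end{aligned}$$ -/

import Mathlib

open Set Filter Topology MeasureTheory
open scoped ENNReal

noncomputable section

namespace BVRis

variable {X : Type*} [NormedAddCommGroup X] [NormedSpace ℝ X]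

/-! ### Dissipation potentials -/

/-- `Ψ₀` is a gauge function: nonnegative, non-degenerate, subadditive and positively
`1`-homogeneous (hence convex). -/
structure IsGauge (Ψ₀ : X → ℝ) : Prop where
  nonneg : ∀ v, 0 ≤ Ψ₀ v
  pos : ∀ v, v ≠ 0 → 0 < Ψ₀ v
  add_le : ∀ v₁ v₂, Ψ₀ (v₁ + v₂) ≤ Ψ₀ v₁ + Ψ₀ v₂
  smul : ∀ (c : ℝ) (v : X), 0 ≤ c → Ψ₀ (c • v) = c * Ψ₀ v

/-- The rescaled viscous potential `Ψ_ε(v) = ε⁻¹ Ψ(ε v)`. -/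
def rescaled (Ψ : X → ℝ) (ε : ℝ) (v : X) : ℝ := ε⁻¹ * Ψ (ε • v)

/-- `Ψ` is a convex superlinear potential with `Ψ(0) = 0` whose rescalings `Ψ_ε` converge
pointwise to `Ψ₀` as `ε ↓ 0`. -/
structure IsViscousPotential (Ψ Ψ₀ : X → ℝ) : Prop where
  nonneg : ∀ v, 0 ≤ Ψ v
  convex : ConvexOn ℝ univ Ψ
  zero : Ψ 0 = 0
  superlinear : Tendsto (fun v : X => Ψ v / ‖v‖) (comap norm atTop) atTop
  tendsto : ∀ v, Tendsto (fun ε : ℝ => rescaled Ψ ε v) (𝓝[>] 0) (𝓝 (Ψ₀ v))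

/-- The Legendre conjugate `Ψ*(w) = sup_v (⟨w, v⟩ - Ψ(v))`. The supremum is over a set bounded
above when `Ψ` is a viscous potential on a finite-dimensional space. -/
def conjugate (Ψ : X → ℝ) (w : X →L[ℝ] ℝ) : ℝ := ⨆ v : X, (w v - Ψ v)

/-- The subdifferential of a convex function `Φ` at `v`. -/
def subdiff (Φ : X → ℝ) (v : X) : Set (X →L[ℝ] ℝ) := {w | ∀ z, Φ v + w (z - v) ≤ Φ z}

/-- The stable set `K* = {w : ⟨w, z⟩ ≤ Ψ₀(z) for all z}`, that is, `∂Ψ₀(0)`. -/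
def stableSet (Ψ₀ : X → ℝ) : Set (X →L[ℝ] ℝ) := {w | ∀ z, w z ≤ Ψ₀ z}

/-- The vanishing viscosity contact potential
`𝔭(v, w) = inf_{ε > 0} (Ψ_ε(v) + ε⁻¹ Ψ*(w))`, where `ε⁻¹ Ψ*` is the conjugate of `Ψ_ε`. -/
def contactPotential (Ψ : X → ℝ) (v : X) (w : X →L[ℝ] ℝ) : ℝ :=
  ⨅ ε : Ioi (0 : ℝ), (rescaled Ψ ε v + (ε : ℝ)⁻¹ * conjugate Ψ w)

/-! ### The energy -/

/-- The partial time derivative of the energy, one-sided at `0` and `T`. -/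
def dtE (T : ℝ) (E : ℝ → X → ℝ) (t : ℝ) (x : X) : ℝ :=
  derivWithin (fun s => E s x) (Icc 0 T) t

/-- The differential `DE_t(x)` of the energy with respect to the state. -/
def DE (E : ℝ → X → ℝ) (t : ℝ) (x : X) : X →L[ℝ] ℝ := fderiv ℝ (E t) x

/-- `E ∈ C¹([0,T] × X)`, bounded below, with energy-bounded time derivative. -/
structure IsEnergy (T : ℝ) (E : ℝ → X → ℝ) : Prop where
  contDiff : ContDiffOn ℝ 1 (fun q : ℝ × X => E q.1 q.2) (Icc 0 T ×ˢ univ)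
  bound : ∃ C > 0, ∀ t ∈ Icc 0 T, ∀ x, -C ≤ E t x ∧ |dtE T E t x| ≤ C * (1 + max (E t x) 0)

/-! ### The Finsler cost -/

/-- The Finsler cost `Δ_{𝔭,E}(t; x₀, x₁)`: the infimum of
`∫ 𝔭(θ'(r), -DE_t(θ(r))) dr` over `[r₀, r₁]`, among all absolutely continuous curves `θ` on some
interval `[r₀, r₁]` joining `x₀` to `x₁`. -/
def finslerCost (Ψ : X → ℝ) (E : ℝ → X → ℝ) (t : ℝ) (x₀ x₁ : X) : ℝ≥0∞ :=
  ⨅ (r₀ : ℝ) (r₁ : ℝ) (θ : ℝ → X)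
    (_ : r₀ < r₁ ∧ AbsolutelyContinuousOnInterval θ r₀ r₁ ∧ θ r₀ = x₀ ∧ θ r₁ = x₁),
    ∫⁻ r in Ioo r₀ r₁, ENNReal.ofReal (contactPotential Ψ (deriv θ r) (-DE E t (θ r)))

/-! ### Curves of bounded variation -/

/-- The extension of `u : [0,T] → X` by its end values. -/
def extendEnds (T : ℝ) (u : ℝ → X) (t : ℝ) : X := u (max 0 (min T t))

/-- The left limit `u(t₋)`, with `u(0₋) = u(0)`. -/
def leftVal (T : ℝ) (u : ℝ → X) (t : ℝ) : X := Function.leftLim (extendEnds T u) t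

/-- The right limit `u(t₊)`, with `u(T₊) = u(T)`. -/
def rightVal (T : ℝ) (u : ℝ → X) (t : ℝ) : X := Function.rightLim (extendEnds T u) t

/-- The pointwise jump set `J_u`. -/
def jumpSet (T : ℝ) (u : ℝ → X) : Set ℝ :=
  {t ∈ Icc 0 T | leftVal T u t ≠ u t ∨ u t ≠ rightVal T u t}

/-- The essential jump set. -/
def essJumpSet (T : ℝ) (u : ℝ → X) : Set ℝ :=
  {t ∈ Icc 0 T | leftVal T u t ≠ rightVal T u t}

open scoped Classical in
/-- The distributional derivative `u'` of `u ∈ BV([0,T]; X)`, an `X`-valued measure concentrated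
on `(0,T)`: it gives mass `u(b₋) - u(a₊)` to `(a,b)` for `0 ≤ a < b ≤ T`. -/
def distDeriv [FiniteDimensional ℝ X] (T : ℝ) (u : ℝ → X) : VectorMeasure ℝ X :=
  haveI : CompleteSpace X := FiniteDimensional.complete ℝ X
  if h : BoundedVariationOn (extendEnds T u) univ then h.vectorMeasure.restrict (Ioo 0 T) else 0

/-- The jump part `u'_J`. -/
def jumpPart [FiniteDimensional ℝ X] (T : ℝ) (u : ℝ → X) : VectorMeasure ℝ X :=
  (distDeriv T u).restrict (essJumpSet T u)

/-- The diffuse part `u'_co = u' - u'_J`. -/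
def diffusePart [FiniteDimensional ℝ X] (T : ℝ) (u : ℝ → X) : VectorMeasure ℝ X :=
  distDeriv T u - jumpPart T u

/-- The absolutely continuous part, whose Lebesgue density is the a.e. derivative of `u`. -/
def acPart (T : ℝ) (u : ℝ → X) : VectorMeasure ℝ X :=
  (volume.restrict (Ioo 0 T)).withDensityᵥ (deriv u)

/-- The Cantor part `u'_C`. -/
def cantorPart [FiniteDimensional ℝ X] (T : ℝ) (u : ℝ → X) : VectorMeasure ℝ X :=
  diffusePart T u - acPart T u

/-- The reference measure `μ = ℒ¹ + |u'_C|` on `(0,T)`. -/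
def refMeasure [FiniteDimensional ℝ X] (T : ℝ) (u : ℝ → X) : Measure ℝ :=
  volume.restrict (Ioo 0 T) + (cantorPart T u).variation

open scoped Classical in
/-- A Radon–Nikodym density `dν/dμ` of the vector measure `ν` (unique up to `μ`-null sets;
`0` if there is none). -/
def density (ν : VectorMeasure ℝ X) (μ : Measure ℝ) : ℝ → X :=
  if h : ∃ f : ℝ → X, StronglyMeasurable f ∧ Integrable f μ ∧ μ.withDensityᵥ f = ν
  then h.choose else 0

/-- The density `du'_co/dμ`. -/
def diffuseDensity [FiniteDimensional ℝ X] (T : ℝ) (u : ℝ → X) : ℝ → X :=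
  density (diffusePart T u) (refMeasure T u)

/-! ### The total variation induced by `(𝔭, E)` -/

/-- The integral of `Ψ₀(du'_co/dμ)` over `(a,b)` with respect to `μ`. -/
def diffuseVar [FiniteDimensional ℝ X] (Ψ₀ : X → ℝ) (T : ℝ) (u : ℝ → X) (a b : ℝ) : ℝ≥0∞ :=
  ∫⁻ t in Ioo a b, ENNReal.ofReal (Ψ₀ (diffuseDensity T u t)) ∂(refMeasure T u)

/-- The jump variation of `u` induced by `(𝔭, E)` on `[a,b]`, `a < b`. -/
def jumpVar (Ψ : X → ℝ) (E : ℝ → X → ℝ) (T : ℝ) (u : ℝ → X) (a b : ℝ) : ℝ≥0∞ :=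
  finslerCost Ψ E a (u a) (rightVal T u a) + finslerCost Ψ E b (leftVal T u b) (u b) +
    ∑' t : ↥(jumpSet T u ∩ Ioo a b),
      (finslerCost Ψ E t (leftVal T u t) (u t) + finslerCost Ψ E t (u t) (rightVal T u t))

open scoped Classical in
/-- The total variation of `u` induced by `(𝔭, E)` on `[a,b]`; it is `0` on a degenerate
interval. -/
def totalVar [FiniteDimensional ℝ X] (Ψ Ψ₀ : X → ℝ) (E : ℝ → X → ℝ) (T : ℝ) (u : ℝ → X)
    (a b : ℝ) : ℝ≥0∞ :=
  if a < b then diffuseVar Ψ₀ T u a b + jumpVar Ψ E T u a b else 0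

/-! ### Solutions -/

/-- A curve `u ∈ BV([0,T]; X)` is a BV solution if it satisfies local stability and the
`(𝔭, E)`-energy balance. The balance is an identity in `[-∞, ∞]`, so that it contains the
finiteness of the variation. -/
structure IsBVSolution [FiniteDimensional ℝ X] (Ψ Ψ₀ : X → ℝ) (E : ℝ → X → ℝ) (T : ℝ)
    (u : ℝ → X) : Prop where
  bv : BoundedVariationOn u (Icc 0 T)
  stable : ∀ᵐ t ∂(volume.restrict (Icc 0 T \ jumpSet T u)), -DE E t (u t) ∈ stableSet Ψ₀
  balance : ∀ t ∈ Icc 0 T,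
    ((totalVar Ψ Ψ₀ E T u 0 t : ℝ≥0∞) : EReal) + ((E t (u t) : ℝ) : EReal) =
      ((E 0 (u 0) + ∫ s in (0 : ℝ)..t, dtE T E s (u s) : ℝ) : EReal)

/-- The doubly nonlinear inclusion `∂Ψ₀(du'_co/dμ(t)) + DE_t(u(t)) ∋ 0` for `μ`-a.e. `t`. -/
def SatisfiesInclusion [FiniteDimensional ℝ X] (Ψ₀ : X → ℝ) (E : ℝ → X → ℝ) (T : ℝ)
    (u : ℝ → X) : Prop :=
  ∀ᵐ t ∂(refMeasure T u), ∃ ξ ∈ subdiff Ψ₀ (diffuseDensity T u t), ξ + DE E t (u t) = 0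

/-- The jump condition `E_t(x₁) - E_t(x₀) = -Δ_{𝔭,E}(t; x₀, x₁)`; in particular the cost is
finite. -/
def DropEqCost (Ψ : X → ℝ) (E : ℝ → X → ℝ) (t : ℝ) (x₀ x₁ : X) : Prop :=
  ((E t x₁ - E t x₀ : ℝ) : EReal) = -((finslerCost Ψ E t x₀ x₁ : ℝ≥0∞) : EReal)

end BVRis

end

/-! The energy balance is a sum of inequalities that can only hold if each of them is an equality.
The chain rule along a curve of bounded variation (`IsJumpDiffuse.chain_rule`, rewritten in
`energy_drop`) splits the energy lost between `u(0₊)` and `u(t₋)`, corrected by the work of `∂ₜE`,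
into the integral of `⟨-DE, du'_co/dμ⟩` against `μ` and the energy drops at the jumps. The balance
says that the same loss, with the end jumps included, equals the integral of `Ψ₀(du'_co/dμ)` plus
the jump costs.

These terms compare one by one. Stability gives `⟨-DE, v⟩ ≤ Ψ₀(v)`. The Fenchel–Young inequality
`⟨w, v⟩ ≤ 𝔭(v, w)`, integrated along transition curves, gives `E(x₀) - E(x₁) ≤ Δ(x₀, x₁)`
(`ofReal_sub_le_finslerCost`). Hence the balance at time `T` forces equality `μ`-a.e. and at every
jump. Since `∂Ψ₀(v)` consists of the `w ∈ K*` with `⟨w, v⟩ = Ψ₀(v)`, the first equality is the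
inclusion. The direct transition from `u(t₋)` to `u(t₊)` follows from the triangle inequality for
`Δ` (`dropEqCost_of_add_le`). Conversely, the equalities inserted in the chain rule give the balance
at every `t`.

Stability is assumed only Lebesgue-a.e., while `μ` may charge Lebesgue-null sets. By continuity it
extends to all interior points outside `J_u` (`stable_of_ae_stable`), and the countable set `J_u` is
`μ`-null because `μ` has no atoms.

For the chain rule, the defect is compared with a monotone function `M` that controls time, diffuse
variation and jumps. On each side of a time the curve stays near a one-sided limit, where the energy
is almost affine, and for affine functions the rule is exact. The increments of the defect are thus
locally at most `ε` times those of `M`, which makes the defect constant. -/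

noncomputable section

namespace BVRis

variable {X : Type*} [NormedAddCommGroup X] [NormedSpace ℝ X]

/-! ### Vector measures in finite dimension -/

section VectorMeasure

variable {α : Type*} [MeasurableSpace α]

/-- The coordinate of a vector measure along a continuous linear functional. -/
def coordMeasure (ν : VectorMeasure α X) (l : X →L[ℝ] ℝ) : SignedMeasure α :=
  ν.mapRange (l : X →+ ℝ) l.continuous

@[simp] lemma coordMeasure_apply (ν : VectorMeasure α X) (l : X →L[ℝ] ℝ) (s : Set α) :
    coordMeasure ν l s = l (ν s) := rfl

instance isFiniteMeasure_variation_signedMeasure (ν : SignedMeasure α) :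
    IsFiniteMeasure ν.variation := by
  rw [← SignedMeasure.totalVariation_eq_variation, SignedMeasure.totalVariation]
  infer_instance

/-- The coordinate functionals of a basis of a finite-dimensional space. -/
def coordCLM [FiniteDimensional ℝ X] (i : Module.Basis.ofVectorSpaceIndex ℝ X) : X →L[ℝ] ℝ :=
  LinearMap.toContinuousLinearMap ((Module.Basis.ofVectorSpace ℝ X).coord i)

lemma sum_coordCLM_smul [FiniteDimensional ℝ X] (v : X) :
    ∑ i, coordCLM i v • (Module.Basis.ofVectorSpace ℝ X) i = v :=
  (Module.Basis.ofVectorSpace ℝ X).sum_repr v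

/-- The coordinates are signed measures, whose variation is finite; a weighted sum of these
variations dominates `‖ν s‖`, hence the variation of `ν`. -/
instance isFiniteMeasure_variation [FiniteDimensional ℝ X] (ν : VectorMeasure α X) :
    IsFiniteMeasure ν.variation := by
  set b := Module.Basis.ofVectorSpace ℝ X
  refine isFiniteMeasure_of_le
    (∑ i, ‖b i‖₊ • (coordMeasure ν (coordCLM i)).variation) ?_
  refine VectorMeasure.variation_le_of_forall_enorm_le fun s _ => ?_
  rw [Measure.finsetSum_apply]
  calc ‖ν s‖ₑ = ‖∑ i, coordCLM i (ν s) • b i‖ₑ := by rw [sum_coordCLM_smul]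
    _ ≤ ∑ i, ‖coordCLM i (ν s) • b i‖ₑ := enorm_sum_le _ _
    _ ≤ _ := by
      refine Finset.sum_le_sum fun i _ => ?_
      rw [enorm_smul, mul_comm, Measure.smul_apply, ENNReal.smul_def, smul_eq_mul]
      exact mul_le_mul_right
        (VectorMeasure.enorm_measure_le_variation (coordMeasure ν (coordCLM i)) s) _

/-- The Radon–Nikodym theorem for vector measures in a finite-dimensional space. -/
theorem exists_withDensityᵥ_eq [FiniteDimensional ℝ X] (ν : VectorMeasure α X) (μ : Measure α)
    [SigmaFinite μ] (h : ∀ s, MeasurableSet s → μ s = 0 → ν s = 0) :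
    ∃ f : α → X, StronglyMeasurable f ∧ Integrable f μ ∧ μ.withDensityᵥ f = ν := by
  have : CompleteSpace X := FiniteDimensional.complete ℝ X
  set b := Module.Basis.ofVectorSpace ℝ X
  let g : Module.Basis.ofVectorSpaceIndex ℝ X → α → ℝ :=
    fun i => (coordMeasure ν (coordCLM i)).rnDeriv μ
  have hgm : ∀ i, StronglyMeasurable (g i) := fun i =>
    (SignedMeasure.measurable_rnDeriv _ _).stronglyMeasurable
  have hgi : ∀ i, Integrable (g i) μ := fun i => SignedMeasure.integrable_rnDeriv _ _
  have hi : ∀ i, Integrable (fun a => g i a • b i) μ := fun i => (hgi i).smul_const _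
  have hf : Integrable (fun a => ∑ i, g i a • b i) μ := integrable_finsetSum _ fun i _ => hi i
  refine ⟨fun a => ∑ i, g i a • b i,
    Finset.stronglyMeasurable_fun_sum _ fun i _ => (hgm i).smul_const _, hf, ?_⟩
  ext s hs
  rw [withDensityᵥ_apply hf hs, integral_finsetSum _ fun i _ => (hi i).integrableOn]
  conv_rhs => rw [← sum_coordCLM_smul (ν s)]
  refine Finset.sum_congr rfl fun i _ => ?_
  rw [integral_smul_const]
  congr 1
  have hac : coordMeasure ν (coordCLM i) ≪ᵥ μ.toENNRealVectorMeasure := by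
    refine VectorMeasure.AbsolutelyContinuous.mk fun t ht h0 => ?_
    rw [Measure.toENNRealVectorMeasure_apply_measurable ht] at h0
    rw [coordMeasure_apply, h t ht h0, map_zero]
  rw [← withDensityᵥ_apply (hgi i) hs, SignedMeasure.withDensityᵥ_rnDeriv_eq _ _ hac,
    coordMeasure_apply]

/-- A vector measure on a countable set is the sum of its atoms. -/
lemma hasSum_singleton_of_countable [MeasurableSingletonClass α] {Y : Type*}
    [NormedAddCommGroup Y] (ν : VectorMeasure α Y)
    {s : Set α} (hs : s.Countable) : HasSum (fun x : s => ν {(x : α)}) (ν s) := by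
  have := hs.to_subtype
  have := VectorMeasure.hasSum_of_disjoint_iUnion (v := ν) (f := fun x : s => {(x : α)})
    (fun _ => measurableSet_singleton _)
    (fun x y hxy => by
      simpa [Function.onFun, Subtype.ext_iff] using fun h : (x : α) = y => hxy (Subtype.ext h))
  simpa using this

end VectorMeasure

/-! ### Curves of bounded variation -/

/-- A curve of bounded variation has at most countably many discontinuities. -/
lemma countable_not_continuousAt [FiniteDimensional ℝ X] {f : ℝ → X}
    (hf : BoundedVariationOn f univ) : {t | ¬ ContinuousAt f t}.Countable := by
  have h : ∀ i : Module.Basis.ofVectorSpaceIndex ℝ X,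
      {t | ¬ ContinuousAt (fun s => coordCLM i (f s)) t}.Countable := by
    intro i
    have hi : BoundedVariationOn (fun s => coordCLM i (f s)) univ :=
      (coordCLM i).lipschitz.comp_boundedVariationOn hf
    -- Jordan decomposition: each coordinate is a difference of monotone functions.
    obtain ⟨p, q, hp, hq, hpq⟩ := hi.locallyBoundedVariationOn.exists_monotoneOn_sub_monotoneOn
    rw [monotoneOn_univ] at hp hq
    refine (hp.countable_not_continuousAt.union hq.countable_not_continuousAt).mono ?_
    intro t ht
    by_contra hcon
    simp only [mem_union, mem_ofPred_eq, not_or, not_not] at hcon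
    exact ht (hpq ▸ hcon.1.sub hcon.2)
  refine (countable_iUnion h).mono ?_
  intro t ht
  by_contra hcon
  simp only [mem_iUnion, mem_ofPred_eq, not_exists, not_not] at hcon
  refine ht ?_
  have : f = fun s => ∑ i, coordCLM i (f s) • (Module.Basis.ofVectorSpace ℝ X) i := by
    funext s; rw [sum_coordCLM_smul]
  rw [this]
  exact tendsto_finsetSum _ fun i _ => (hcon i).smul_const _

lemma boundedVariationOn_extendEnds {Y : Type*} [NormedAddCommGroup Y] {T : ℝ} (hT : 0 ≤ T)
    {u : ℝ → Y}
    (hu : BoundedVariationOn u (Icc 0 T)) : BoundedVariationOn (extendEnds T u) univ := by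
  refine ne_top_of_le_ne_top hu ?_
  refine eVariationOn.comp_le_of_monotoneOn u (fun t => max 0 (min T t)) ?_ ?_
  · intro x _ y _ hxy
    dsimp only
    gcongr
  · intro x _
    exact ⟨le_max_left _ _, max_le hT (min_le_left _ _)⟩

/-! ### The contact potential -/

section Contact

variable {Ψ Ψ₀ : X → ℝ}

/-- By superlinearity `Ψ(v) ≥ ‖w‖ ‖v‖` for `v ≠ 0` outside a ball, so the difference is nonpositive
there; inside the ball `w v` is bounded and `Ψ ≥ 0`. -/
lemma IsViscousPotential.bddAbove [FiniteDimensional ℝ X] (hΨ : IsViscousPotential Ψ Ψ₀)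
    (w : X →L[ℝ] ℝ) : BddAbove (range fun v : X => w v - Ψ v) := by
  have h := hΨ.superlinear.eventually_ge_atTop ‖w‖
  rw [eventually_comap] at h
  obtain ⟨R, hR⟩ := eventually_atTop.1 h
  refine ⟨‖w‖ * max R 0, ?_⟩
  rintro _ ⟨v, rfl⟩
  have hw : w v ≤ ‖w‖ * ‖v‖ := (le_abs_self _).trans (w.le_opNorm v)
  have hb : (0 : ℝ) ≤ ‖w‖ * max R 0 := by positivity
  rcases le_total R ‖v‖ with hv | hv
  · have h1 := hR ‖v‖ hv v rfl
    rcases eq_or_ne v 0 with rfl | hv0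
    · simpa [hΨ.zero] using hb
    · rw [le_div_iff₀ (norm_pos_iff.2 hv0)] at h1
      dsimp only
      linarith
  · have h1 : ‖w‖ * ‖v‖ ≤ ‖w‖ * max R 0 := by gcongr; exact hv.trans (le_max_left _ _)
    have h2 := hΨ.nonneg v
    dsimp only
    linarith

lemma IsViscousPotential.le_conjugate [FiniteDimensional ℝ X] (hΨ : IsViscousPotential Ψ Ψ₀)
    (w : X →L[ℝ] ℝ) (v : X) : w v - Ψ v ≤ conjugate Ψ w :=
  le_ciSup (hΨ.bddAbove w) v

lemma IsViscousPotential.conjugate_nonneg [FiniteDimensional ℝ X]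
    (hΨ : IsViscousPotential Ψ Ψ₀) (w : X →L[ℝ] ℝ) : 0 ≤ conjugate Ψ w := by
  simpa [hΨ.zero] using hΨ.le_conjugate w 0

/-- The Fenchel–Young inequality for the contact potential. -/
lemma IsViscousPotential.le_contactPotential [FiniteDimensional ℝ X]
    (hΨ : IsViscousPotential Ψ Ψ₀) (v : X) (w : X →L[ℝ] ℝ) : w v ≤ contactPotential Ψ v w := by
  have : Nonempty (Ioi (0 : ℝ)) := ⟨⟨1, mem_Ioi.2 one_pos⟩⟩
  refine le_ciInf fun ε => ?_
  have hε : (0 : ℝ) < ε := ε.2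
  -- Fenchel–Young at `ε v`, divided by `ε`, bounds `w v` by the competitor for each `ε`.
  have h := hΨ.le_conjugate w ((ε : ℝ) • v)
  rw [map_smul, smul_eq_mul] at h
  rw [rescaled, ← mul_add, ← div_eq_inv_mul, le_div_iff₀ hε]
  linarith

/-- At `v = 0` only `ε⁻¹ Ψ*(w)` remains, and it tends to `0` as `ε → ∞`. Constant curves are
therefore free. -/
lemma IsViscousPotential.contactPotential_zero [FiniteDimensional ℝ X]
    (hΨ : IsViscousPotential Ψ Ψ₀) (w : X →L[ℝ] ℝ) : contactPotential Ψ 0 w ≤ 0 := by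
  have hb : BddBelow (range fun ε : Ioi (0 : ℝ) =>
      rescaled Ψ (ε : ℝ) (0 : X) + (ε : ℝ)⁻¹ * conjugate Ψ w) := by
    refine ⟨0, ?_⟩
    rintro _ ⟨ε, rfl⟩
    have hε : (0 : ℝ) < ε := ε.2
    have := hΨ.conjugate_nonneg w
    have := hΨ.nonneg ((ε : ℝ) • (0 : X))
    unfold rescaled
    positivity
  have hlim : Tendsto (fun ε : ℝ => ε⁻¹ * conjugate Ψ w) atTop (𝓝 0) := by
    simpa using tendsto_inv_atTop_zero.mul_const (conjugate Ψ w)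
  refine ge_of_tendsto hlim ?_
  filter_upwards [eventually_gt_atTop 0] with ε hε
  have h := ciInf_le hb ⟨ε, hε⟩
  simpa [contactPotential, rescaled, hΨ.zero] using h

end Contact

/-! ### Absolutely continuous curves -/

section Glue

variable {Y : Type*} [NormedAddCommGroup Y]

/-- Monotonicity keeps disjoint intervals disjoint, and the Lipschitz constant `1` does not increase
their total length, so the same `δ` works. -/
lemma absolutelyContinuous_comp_of_monotone {f : ℝ → Y} {φ : ℝ → ℝ}
    {a b c d : ℝ} (hf : AbsolutelyContinuousOnInterval f c d) (hmono : Monotone φ)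
    (hlip : ∀ x y, dist (φ x) (φ y) ≤ dist x y) (hmaps : MapsTo φ (uIcc a b) (uIcc c d)) :
    AbsolutelyContinuousOnInterval (fun t => f (φ t)) a b := by
  rw [absolutelyContinuousOnInterval_iff] at hf ⊢
  intro ε hε
  obtain ⟨δ, hδ, h⟩ := hf ε hε
  refine ⟨δ, hδ, fun E hE hlen => ?_⟩
  refine h (E.1, fun i => (φ (E.2 i).1, φ (E.2 i).2)) ⟨?_, ?_⟩ ?_
  · intro i hi
    exact ⟨hmaps (hE.1 i hi).1, hmaps (hE.1 i hi).2⟩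
  · intro i hi j hj hij
    have hd := hE.2 hi hj hij
    simp only [Function.onFun, uIoc, Set.Ioc_disjoint_Ioc] at hd ⊢
    rw [← hmono.map_min, ← hmono.map_max, ← hmono.map_min, ← hmono.map_max,
      ← hmono.map_min, ← hmono.map_max]
    exact hmono hd
  · exact (Finset.sum_le_sum fun i _ => hlip _ _).trans_lt hlen

lemma absolutelyContinuous_congr {f g : ℝ → Y} {a b : ℝ}
    (hf : AbsolutelyContinuousOnInterval f a b) (h : EqOn f g (uIcc a b)) :
    AbsolutelyContinuousOnInterval g a b := by
  rw [absolutelyContinuousOnInterval_iff] at hf ⊢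
  intro ε hε
  obtain ⟨δ, hδ, hE⟩ := hf ε hε
  refine ⟨δ, hδ, fun E hE' hlen => ?_⟩
  refine lt_of_eq_of_lt (Finset.sum_congr rfl fun i hi => ?_) (hE E hE' hlen)
  rw [h (hE'.1 i hi).1, h (hE'.1 i hi).2]

/-- Absolute continuity of a curve glued from two pieces. -/
lemma absolutelyContinuous_glue {f : ℝ → Y} {a b c : ℝ} (hab : a ≤ b) (hbc : b ≤ c)
    (h₁ : AbsolutelyContinuousOnInterval f a b) (h₂ : AbsolutelyContinuousOnInterval f b c) :
    AbsolutelyContinuousOnInterval f a c := by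
  have hl : ∀ x y : ℝ, dist (min x b) (min y b) ≤ dist x y := fun x y => by
    simpa [Real.dist_eq] using abs_min_sub_min_le_max x b y b
  have hr : ∀ x y : ℝ, dist (max x b) (max y b) ≤ dist x y := fun x y => by
    simpa [Real.dist_eq] using abs_max_sub_max_le_max x b y b
  have A := absolutelyContinuous_comp_of_monotone (a := a) (b := c) h₁
    (φ := fun x => min x b) (fun x y h => min_le_min_right b h) hl (by
      intro x hx
      rw [uIcc_of_le (hab.trans hbc)] at hx
      rw [uIcc_of_le hab]
      exact ⟨le_min hx.1 hab, min_le_right _ _⟩)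
  have B := absolutelyContinuous_comp_of_monotone (a := a) (b := c) h₂
    (φ := fun x => max x b) (fun x y h => max_le_max_right b h) hr (by
      intro x hx
      rw [uIcc_of_le (hab.trans hbc)] at hx
      rw [uIcc_of_le hbc]
      exact ⟨le_max_right _ _, max_le hx.2 hbc⟩)
  -- The gluing rests on `f x = f (min x b) + f (max x b) - f b`.
  have hc : AbsolutelyContinuousOnInterval (fun _ : ℝ => f b) a c :=
    (LipschitzWith.const (f b)).lipschitzOnWith.absolutelyContinuousOnInterval
  refine absolutelyContinuous_congr ((A.add B).sub hc) fun x _ => ?_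
  rcases le_total x b with h | h <;> simp [h]

lemma absolutelyContinuous_lipschitz_comp {g : Y → ℝ} {K : NNReal} {s : Set Y}
    (hg : LipschitzOnWith K g s) {f : ℝ → Y} {a b : ℝ}
    (hf : AbsolutelyContinuousOnInterval f a b) (hs : MapsTo f (uIcc a b) s) :
    AbsolutelyContinuousOnInterval (fun t => g (f t)) a b := by
  rw [absolutelyContinuousOnInterval_iff] at hf ⊢
  intro ε hε
  obtain ⟨δ, hδ, hE⟩ := hf (ε / (K + 1)) (by positivity)
  refine ⟨δ, hδ, fun E hE' hlen => ?_⟩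
  have h1 := hE E hE' hlen
  rw [lt_div_iff₀ (by positivity)] at h1
  calc ∑ i ∈ Finset.range E.1, dist (g (f (E.2 i).1)) (g (f (E.2 i).2))
      ≤ ∑ i ∈ Finset.range E.1, K * dist (f (E.2 i).1) (f (E.2 i).2) :=
        Finset.sum_le_sum fun i hi => hg.dist_le_mul _ (hs (hE'.1 i hi).1) _ (hs (hE'.1 i hi).2)
    _ = K * ∑ i ∈ Finset.range E.1, dist (f (E.2 i).1) (f (E.2 i).2) := by rw [Finset.mul_sum]
    _ ≤ (∑ i ∈ Finset.range E.1, dist (f (E.2 i).1) (f (E.2 i).2)) * (K + 1) := by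
        have : 0 ≤ ∑ i ∈ Finset.range E.1, dist (f (E.2 i).1) (f (E.2 i).2) :=
          Finset.sum_nonneg fun _ _ => dist_nonneg
        nlinarith
    _ < ε := h1

end Glue

/-- The chain rule along an absolutely continuous curve. -/
lemma integral_fderiv_comp_eq_sub [FiniteDimensional ℝ X] {g : X → ℝ} (hg : ContDiff ℝ 1 g)
    {θ : ℝ → X} {a b : ℝ} (hθ : AbsolutelyContinuousOnInterval θ a b) :
    IntervalIntegrable (fun r => fderiv ℝ g (θ r) (deriv θ r)) volume a b ∧
      ∫ r in a..b, fderiv ℝ g (θ r) (deriv θ r) = g (θ b) - g (θ a) := by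
  have : ProperSpace X := FiniteDimensional.proper ℝ X
  -- The curve stays in a closed ball, which is compact and convex, so the `C¹` function `g` is
  -- Lipschitz there and `g ∘ θ` is absolutely continuous.
  obtain ⟨C, hC⟩ := hθ.exists_bound
  obtain ⟨K, hK⟩ := hg.contDiffOn.exists_lipschitzOnWith (by decide)
    (convex_closedBall (0 : X) C) (isCompact_closedBall 0 C)
  have hac : AbsolutelyContinuousOnInterval (fun t => g (θ t)) a b :=
    absolutelyContinuous_lipschitz_comp hK hθ fun x hx => by simpa using hC x hx
  have hae : ∀ᵐ r, r ∈ uIcc a b →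
      deriv (fun t => g (θ t)) r = fderiv ℝ g (θ r) (deriv θ r) := by
    filter_upwards [hθ.boundedVariationOn.ae_differentiableAt_of_mem_uIcc] with r hr hmem
    exact fderiv_comp_deriv r (hg.differentiable (by decide) _) (hr hmem)
  have hae' : ∀ᵐ r, r ∈ uIoc a b →
      deriv (fun t => g (θ t)) r = fderiv ℝ g (θ r) (deriv θ r) := by
    filter_upwards [hae] with r hr hmem using hr (uIoc_subset_uIcc hmem)
  refine ⟨hac.intervalIntegrable_deriv.congr_ae ?_, ?_⟩
  · exact (ae_restrict_iff' measurableSet_uIoc).2 hae'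
  · rw [← hac.integral_deriv_eq_sub]
    exact (intervalIntegral.integral_congr_ae hae').symm

/-! ### The Finsler cost -/

section Cost

variable {Ψ Ψ₀ : X → ℝ} {E : ℝ → X → ℝ} {t : ℝ}

/-- Along any admissible curve the energy loss is the integral of `⟨-DE, θ'⟩`, which Fenchel–Young
bounds pointwise by the contact potential. -/
lemma ofReal_sub_le_finslerCost [FiniteDimensional ℝ X] (hΨ : IsViscousPotential Ψ Ψ₀)
    (hE : ContDiff ℝ 1 (E t)) (x₀ x₁ : X) : ENNReal.ofReal (E t x₀ - E t x₁) ≤ finslerCost Ψ E t x₀ x₁ := by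
  refine le_iInf fun r₀ => le_iInf fun r₁ => le_iInf fun θ => le_iInf fun h => ?_
  obtain ⟨hr, hθ, rfl, rfl⟩ := h
  obtain ⟨hi, he⟩ := integral_fderiv_comp_eq_sub hE hθ
  have hi' : Integrable (fun r => -(fderiv ℝ (E t) (θ r) (deriv θ r)))
      (volume.restrict (Ioo r₀ r₁)) :=
    (((intervalIntegrable_iff_integrableOn_Ioc_of_le hr.le).1 hi).mono_set Ioo_subset_Ioc_self).neg
  have h1 : E t (θ r₀) - E t (θ r₁) =
      ∫ r in Ioo r₀ r₁, -(fderiv ℝ (E t) (θ r) (deriv θ r)) := by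
    rw [integral_neg, ← integral_Ioc_eq_integral_Ioo, ← intervalIntegral.integral_of_le hr.le, he]
    ring
  rw [h1]
  calc ENNReal.ofReal (∫ r in Ioo r₀ r₁, -(fderiv ℝ (E t) (θ r) (deriv θ r)))
      ≤ ∫⁻ r in Ioo r₀ r₁, ENNReal.ofReal (-(fderiv ℝ (E t) (θ r) (deriv θ r))) := by
        rw [integral_eq_lintegral_pos_part_sub_lintegral_neg_part hi']
        refine (ENNReal.ofReal_le_ofReal (sub_le_self _ ENNReal.toReal_nonneg)).trans ?_
        exact ENNReal.ofReal_toReal_le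
    _ ≤ _ := by
        refine lintegral_mono fun r => ENNReal.ofReal_le_ofReal ?_
        simpa [DE] using hΨ.le_contactPotential (deriv θ r) (-DE E t (θ r))

lemma finslerCost_self [FiniteDimensional ℝ X] (hΨ : IsViscousPotential Ψ Ψ₀) (x : X) :
    finslerCost Ψ E t x x = 0 := by
  refine le_antisymm ?_ zero_le
  refine iInf_le_of_le 0 <| iInf_le_of_le 1 <| iInf_le_of_le (fun _ => x) <| iInf_le_of_le
    ⟨one_pos, (LipschitzWith.const x).lipschitzOnWith.absolutelyContinuousOnInterval, rfl, rfl⟩ ?_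
  simp [ENNReal.ofReal_eq_zero.2 (hΨ.contactPotential_zero _)]

/-- The triangle inequality for the Finsler cost. -/
lemma finslerCost_triangle (x y z : X) :
    finslerCost Ψ E t x z ≤ finslerCost Ψ E t x y + finslerCost Ψ E t y z := by
  simp only [finslerCost, ENNReal.iInf_add, ENNReal.add_iInf]
  refine le_iInf fun s₀ => le_iInf fun s₁ => le_iInf fun η => le_iInf fun hη =>
    le_iInf fun r₀ => le_iInf fun r₁ => le_iInf fun θ => le_iInf fun hθ => ?_
  obtain ⟨hr, hθ, rfl, rfl⟩ := hθ
  obtain ⟨hs, hη, hηy, rfl⟩ := hη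
  -- Concatenation of the two curves, the second shifted in time so as to start at `r₁`.
  set ζ : ℝ → X := fun r => if r ≤ r₁ then θ r else η (r - r₁ + s₀) with hζ
  have hrs : r₁ ≤ r₁ + (s₁ - s₀) := by linarith
  have hζ₁ : EqOn θ ζ (uIcc r₀ r₁) := fun r hr' => by
    rw [uIcc_of_le hr.le] at hr'
    simp [hζ, hr'.2]
  have hζ₂ : EqOn (fun r => η (r - r₁ + s₀)) ζ (uIcc r₁ (r₁ + (s₁ - s₀))) := fun r hr' => by
    rw [uIcc_of_le hrs] at hr'
    rcases hr'.1.eq_or_lt with h | h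
    · simp [hζ, ← h, hηy]
    · simp [hζ, not_le.2 h]
  have hac : AbsolutelyContinuousOnInterval ζ r₀ (r₁ + (s₁ - s₀)) := by
    refine absolutelyContinuous_glue hr.le hrs (absolutelyContinuous_congr hθ hζ₁) ?_
    refine absolutelyContinuous_congr ?_ hζ₂
    refine absolutelyContinuous_comp_of_monotone hη (φ := fun r => r - r₁ + s₀)
      (fun a b h => by dsimp only; linarith) (fun a b => by simp) ?_
    intro r hr'
    rw [uIcc_of_le hrs] at hr'
    rw [uIcc_of_le hs.le]
    constructor <;> linarith [hr'.1, hr'.2]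
  refine iInf_le_of_le r₀ <| iInf_le_of_le (r₁ + (s₁ - s₀)) <| iInf_le_of_le ζ <| iInf_le_of_le
    ⟨by linarith, hac, by simp [hζ, hr.le], ?_⟩ ?_
  · have : ¬ (r₁ + (s₁ - s₀) ≤ r₁) := by linarith
    simp [hζ, this]
  -- The junction `r₁` is a null set. At every other time `ζ` agrees nearby with one of the two
  -- pieces, so the derivatives agree as well.
  have hsub : Ioo r₀ (r₁ + (s₁ - s₀)) ⊆ (Ioo r₀ r₁ ∪ Ioo r₁ (r₁ + (s₁ - s₀))) ∪ {r₁} := by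
    intro r hr'
    rcases lt_trichotomy r r₁ with h | h | h
    · exact .inl (.inl ⟨hr'.1, h⟩)
    · exact .inr h
    · exact .inl (.inr ⟨h, hr'.2⟩)
  refine (lintegral_mono_set hsub).trans ?_
  refine (lintegral_union_le _ _ _).trans ?_
  simp only [Measure.restrict_singleton, Real.volume_singleton, zero_smul, lintegral_zero_measure,
    add_zero]
  refine (lintegral_union_le _ _ _).trans (add_le_add (le_of_eq ?_) (le_of_eq ?_))
  · refine setLIntegral_congr_fun measurableSet_Ioo fun r hr' => ?_
    have : ζ =ᶠ[𝓝 r] θ := by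
      filter_upwards [Iio_mem_nhds hr'.2] with s hs'
      simp [hζ, (mem_Iio.1 hs').le]
    simp only [this.deriv_eq, this.eq_of_nhds]
  · have hcongr : ∫⁻ r in Ioo r₁ (r₁ + (s₁ - s₀)),
        ENNReal.ofReal (contactPotential Ψ (deriv ζ r) (-DE E t (ζ r))) =
        ∫⁻ r in Ioo r₁ (r₁ + (s₁ - s₀)), (fun q => ENNReal.ofReal
          (contactPotential Ψ (deriv η q) (-DE E t (η q)))) (r + (s₀ - r₁)) := by
      refine setLIntegral_congr_fun measurableSet_Ioo fun r hr' => ?_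
      have : ζ =ᶠ[𝓝 r] fun s => η (s + (s₀ - r₁)) := by
        filter_upwards [Ioi_mem_nhds hr'.1] with s hs'
        have : s - r₁ + s₀ = s + (s₀ - r₁) := by ring
        simp [hζ, not_le.2 (mem_Ioi.1 hs'), this]
      simp only [this.deriv_eq, this.eq_of_nhds, deriv_comp_add_const]
    have hpre : Ioo r₁ (r₁ + (s₁ - s₀)) = (fun r => r + (s₀ - r₁)) ⁻¹' Ioo s₀ s₁ := by
      rw [preimage_add_const_Ioo]
      congr 1 <;> ring
    rw [hcongr, hpre]
    exact (measurePreserving_add_right volume (s₀ - r₁)).setLIntegral_comp_preimage_emb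
      (measurableEmbedding_addRight _) (fun q => ENNReal.ofReal
        (contactPotential Ψ (deriv η q) (-DE E t (η q)))) (Ioo s₀ s₁)

end Cost

/-! ### The derivative of the energy -/

section Energy

variable {T : ℝ} {E : ℝ → X → ℝ}

/-- The joint differential of the energy on `[0,T] × X`. -/
def energyDeriv (T : ℝ) (E : ℝ → X → ℝ) (q : ℝ × X) : ℝ × X →L[ℝ] ℝ :=
  fderivWithin ℝ (fun q : ℝ × X => E q.1 q.2) (Icc 0 T ×ˢ univ) q

lemma IsEnergy.continuousOn_energyDeriv (hE : IsEnergy T E) (hT : 0 < T) :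
    ContinuousOn (energyDeriv T E) (Icc 0 T ×ˢ univ) :=
  hE.contDiff.continuousOn_fderivWithin ((uniqueDiffOn_Icc hT).prod uniqueDiffOn_univ) (by decide)

lemma IsEnergy.hasFDerivWithinAt (hE : IsEnergy T E) {q : ℝ × X} (hq : q ∈ Icc 0 T ×ˢ univ) :
    HasFDerivWithinAt (fun q : ℝ × X => E q.1 q.2) (energyDeriv T E q) (Icc 0 T ×ˢ univ) q :=
  (hE.contDiff.differentiableOn (by decide) q hq).hasFDerivWithinAt

lemma IsEnergy.contDiff_apply (hE : IsEnergy T E) {t : ℝ} (ht : t ∈ Icc 0 T) :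
    ContDiff ℝ 1 (E t) := by
  rw [← contDiffOn_univ]
  exact hE.contDiff.comp (contDiff_const.prodMk contDiff_id).contDiffOn
    (show MapsTo (fun x : X => (t, x)) univ (Icc 0 T ×ˢ univ) from fun x _ => ⟨ht, mem_univ x⟩)

lemma IsEnergy.dtE_eq (hE : IsEnergy T E) (hT : 0 < T) {t : ℝ} (ht : t ∈ Icc 0 T) (x : X) :
    dtE T E t x = energyDeriv T E (t, x) (1, 0) := by
  have h1 : HasDerivWithinAt (fun s : ℝ => (s, x)) ((1 : ℝ), (0 : X)) (Icc 0 T) t :=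
    (hasDerivWithinAt_id t _).prodMk (hasDerivWithinAt_const t _ x)
  have h2 := (hE.hasFDerivWithinAt (q := (t, x)) ⟨ht, mem_univ _⟩).comp_hasDerivWithinAt t h1
    (show MapsTo (fun s : ℝ => (s, x)) (Icc 0 T) (Icc 0 T ×ˢ univ) from fun s hs => ⟨hs, mem_univ _⟩)
  exact h2.derivWithin (uniqueDiffOn_Icc hT t ht)

lemma IsEnergy.DE_apply (hE : IsEnergy T E) {t : ℝ} (ht : t ∈ Icc 0 T) (x v : X) :
    DE E t x v = energyDeriv T E (t, x) (0, v) := by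
  have h1 : HasFDerivWithinAt (fun y : X => (t, y)) (ContinuousLinearMap.inr ℝ ℝ X) univ x :=
    (hasFDerivWithinAt_const t x univ).prodMk (hasFDerivWithinAt_id x univ)
  have h2 := (hE.hasFDerivWithinAt (q := (t, x)) ⟨ht, mem_univ _⟩).comp x h1
    (show MapsTo (fun y : X => (t, y)) univ (Icc 0 T ×ˢ univ) from fun s _ => ⟨ht, mem_univ _⟩)
  rw [hasFDerivWithinAt_univ] at h2
  have h3 : DE E t x = (energyDeriv T E (t, x)).comp (ContinuousLinearMap.inr ℝ ℝ X) := h2.fderiv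
  rw [h3]
  rfl

end Energy

/-! ### Functions constant up to a monotone error -/

/-- Continuous induction on the supremum of the times up to which the bound holds. The local
hypothesis only compares each `s` with the centre `t`, and `M` may jump; this is what makes it
applicable at discontinuities of the curve. -/
lemma abs_sub_le_of_local {Φ M : ℝ → ℝ} {T ε : ℝ} (hT : 0 ≤ T) (hM : MonotoneOn M (Icc 0 T))
    (h : ∀ t ∈ Icc 0 T, ∃ δ > 0, ∀ s ∈ Icc 0 T, |s - t| < δ → |Φ s - Φ t| ≤ ε * |M s - M t|) :
    ∀ t ∈ Icc 0 T, |Φ t - Φ 0| ≤ ε * (M t - M 0) := by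
  set S : Set ℝ := {t ∈ Icc 0 T | ∀ s ∈ Icc 0 t, |Φ s - Φ 0| ≤ ε * (M s - M 0)} with hS
  have h0S : (0 : ℝ) ∈ S := ⟨⟨le_rfl, hT⟩, fun s hs => by
    have : s = 0 := le_antisymm hs.2 hs.1
    simp [this]⟩
  have hbdd : BddAbove S := ⟨T, fun t ht => ht.1.2⟩
  set c := sSup S with hc
  have hc0 : 0 ≤ c := le_csSup hbdd h0S
  have hcT : c ≤ T := csSup_le ⟨0, h0S⟩ fun t ht => ht.1.2
  have step : ∀ s t, 0 ≤ s → s ≤ t → t ≤ T → |Φ s - Φ 0| ≤ ε * (M s - M 0) →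
      |Φ t - Φ s| ≤ ε * |M t - M s| → |Φ t - Φ 0| ≤ ε * (M t - M 0) := by
    intro s t hs hst ht h1 h2
    have hm : M s ≤ M t := hM ⟨hs, hst.trans ht⟩ ⟨hs.trans hst, ht⟩ hst
    rw [abs_of_nonneg (sub_nonneg.2 hm)] at h2
    calc |Φ t - Φ 0| ≤ |Φ t - Φ s| + |Φ s - Φ 0| := abs_sub_le _ _ _
      _ ≤ ε * (M t - M 0) := by linarith
  obtain ⟨δ, hδ, hloc⟩ := h c ⟨hc0, hcT⟩
  have hlt : ∀ s, 0 ≤ s → s < c → |Φ s - Φ 0| ≤ ε * (M s - M 0) := fun s hs hsc => by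
    obtain ⟨t, ht, hst⟩ := exists_lt_of_lt_csSup ⟨0, h0S⟩ hsc
    exact ht.2 s ⟨hs, hst.le⟩
  have hPc : |Φ c - Φ 0| ≤ ε * (M c - M 0) := by
    rcases hc0.eq_or_lt with h0 | h0
    · simp [← h0]
    -- A point below the supremum within `δ` of it: the bound known at `s` passes to `c` by the
    -- local estimate centred at `c`.
    · set s := max 0 (c - δ / 2) with hs
      have hsc : s < c := max_lt h0 (by linarith)
      have hs0 : 0 ≤ s := le_max_left _ _
      have hsδ : c - δ / 2 ≤ s := le_max_right _ _
      refine step s c hs0 hsc.le hcT (hlt s hs0 hsc) ?_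
      rw [abs_sub_comm (Φ c), abs_sub_comm (M c)]
      refine hloc s ⟨hs0, hsc.le.trans hcT⟩ ?_
      rw [abs_sub_lt_iff]
      constructor <;> linarith
  have hcS : ∀ s ∈ Icc 0 c, |Φ s - Φ 0| ≤ ε * (M s - M 0) := fun s hs => by
    rcases hs.2.eq_or_lt with h | h
    · rw [h]; exact hPc
    · exact hlt s hs.1 h
  rcases hcT.eq_or_lt with h | h
  · rw [← h]; exact hcS
  · exfalso
    set t := min T (c + δ / 2) with ht
    have hct : c < t := lt_min h (by linarith)
    refine absurd (le_csSup hbdd (show t ∈ S from ⟨⟨hc0.trans hct.le, min_le_left _ _⟩, ?_⟩))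
      (not_le.2 hct)
    intro s hs
    rcases le_total s c with hsc | hsc
    · exact hcS s ⟨hs.1, hsc⟩
    · have h1 : s ≤ T := hs.2.trans (min_le_left _ _)
      have h2 : s ≤ c + δ / 2 := hs.2.trans (min_le_right _ _)
      refine step c s hc0 hsc h1 hPc (hloc s ⟨hs.1, h1⟩ ?_)
      rw [abs_sub_lt_iff]
      constructor <;> linarith

/-- The total increment of `M` up to `t` is fixed, so the previous bound vanishes as `ε → 0`. -/
lemma eq_of_local_of_monotoneOn {Φ M : ℝ → ℝ} {T : ℝ} (hT : 0 ≤ T)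
    (hM : MonotoneOn M (Icc 0 T))
    (h : ∀ ε > 0, ∀ t ∈ Icc 0 T, ∃ δ > 0, ∀ s ∈ Icc 0 T, |s - t| < δ →
      |Φ s - Φ t| ≤ ε * |M s - M t|) {t : ℝ} (ht : t ∈ Icc 0 T) : Φ t = Φ 0 := by
  have hlim : Tendsto (fun ε : ℝ => ε * (M t - M 0)) (𝓝[>] 0) (𝓝 0) := by
    have : Tendsto (fun ε : ℝ => ε * (M t - M 0)) (𝓝 0) (𝓝 (0 * (M t - M 0))) :=
      tendsto_id.mul_const _
    rw [zero_mul] at this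
    exact this.mono_left nhdsWithin_le_nhds
  have h0 : |Φ t - Φ 0| ≤ 0 := by
    refine ge_of_tendsto hlim ?_
    filter_upwards [self_mem_nhdsWithin] with ε hε
    exact abs_sub_le_of_local hT hM (h ε hε) t ht
  exact sub_eq_zero.1 (abs_nonpos_iff.1 h0)

/-! ### Sums over the jump points in an interval -/

section JumpSum

variable {Y : Type*} [NormedAddCommGroup Y]

/-- The sum of `g` over the points of `J ∩ A`. -/
def jumpSum (J A : Set ℝ) (g : ℝ → Y) : Y := ∑' r, (J ∩ A).indicator g r

lemma summable_indicator_inter [CompleteSpace Y] {J : Set ℝ} {g : ℝ → Y}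
    (h : Summable (J.indicator g)) (A : Set ℝ) : Summable ((J ∩ A).indicator g) := by
  rw [inter_comm, ← indicator_indicator]
  exact h.indicator A

lemma jumpSum_union [CompleteSpace Y] {J A B : Set ℝ} {g : ℝ → Y} (h : Summable (J.indicator g))
    (hAB : Disjoint A B) : jumpSum J (A ∪ B) g = jumpSum J A g + jumpSum J B g := by
  rw [jumpSum, jumpSum, jumpSum,
    ← (summable_indicator_inter h A).tsum_add (summable_indicator_inter h B)]
  congr 1
  rw [inter_union_distrib_left, indicator_union_of_disjoint
    (hAB.mono inter_subset_right inter_subset_right)]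

lemma jumpSum_singleton {J : Set ℝ} {g : ℝ → Y} {t : ℝ} (h : t ∉ J → g t = 0) :
    jumpSum J {t} g = g t := by
  rw [jumpSum, tsum_eq_single t]
  · by_cases ht : t ∈ J <;> simp [ht, h]
  · intro s hs
    simp [hs]

lemma jumpSum_Ioc_eq [CompleteSpace Y] {J : Set ℝ} {g : ℝ → Y} (h : Summable (J.indicator g))
    {s t : ℝ} (hst : s < t) (ht : t ∉ J → g t = 0) :
    jumpSum J (Ioc s t) g = jumpSum J (Ioo s t) g + g t := by
  rw [← Ioo_union_right hst, jumpSum_union h (by simp), jumpSum_singleton ht]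

lemma jumpSum_Ioc_add [CompleteSpace Y] {J : Set ℝ} {g : ℝ → Y} (h : Summable (J.indicator g))
    {r s t : ℝ} (hrs : r ≤ s) (hst : s ≤ t) :
    jumpSum J (Ioc r t) g = jumpSum J (Ioc r s) g + jumpSum J (Ioc s t) g := by
  rw [← Ioc_union_Ioc_eq_Ioc hrs hst, jumpSum_union h]
  exact Ioc_disjoint_Ioc_of_le le_rfl

lemma norm_jumpSum_le {J : Set ℝ} {g : ℝ → Y} (h : Summable (J.indicator fun r => ‖g r‖))
    (A : Set ℝ) : ‖jumpSum J A g‖ ≤ jumpSum J A fun r => ‖g r‖ := by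
  refine tsum_of_norm_bounded (summable_indicator_inter h A).hasSum fun r => ?_
  rw [norm_indicator_eq_indicator_norm]

lemma jumpSum_nonneg {J A : Set ℝ} {g : ℝ → ℝ} (h : ∀ r, 0 ≤ g r) : 0 ≤ jumpSum J A g :=
  tsum_nonneg fun r => indicator_nonneg (fun _ _ => h _) r

end JumpSum

/-! ### The chain rule for curves of bounded variation -/

/-- A curve `f` with one-sided limits `L` and `R`, whose increments on `[0,T]` split into a diffuse
part with density `ξ` with respect to `μ` and the jumps at the points of a countable set `J`. -/
structure IsJumpDiffuse (T : ℝ) (f L R : ℝ → X) (J : Set ℝ) (μ : Measure ℝ) (ξ : ℝ → X) :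
    Prop where
  left : ∀ t, Tendsto f (𝓝[<] t) (𝓝 (L t))
  right : ∀ t, Tendsto f (𝓝[>] t) (𝓝 (R t))
  bounded : ∃ B, ∀ t, ‖f t‖ ≤ B
  countable : J.Countable
  subset : J ⊆ Icc 0 T
  continuousAt : ∀ t ∈ Icc 0 T, t ∉ J → ContinuousAt f t
  summable : Summable (J.indicator fun r => R r - L r)
  integrable : Integrable ξ μ
  nullSingleton : NullSingletonClass μ
  increment : ∀ s t, 0 ≤ s → s < t → t ≤ T →
    L t - R s = ∫ r in Ioo s t, ξ r ∂μ + jumpSum J (Ioo s t) fun r => R r - L r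

section ChainRule

variable {T : ℝ} {E : ℝ → X → ℝ} {f L R : ℝ → X} {J : Set ℝ} {μ : Measure ℝ} {ξ : ℝ → X}

lemma IsJumpDiffuse.left_mem (h : IsJumpDiffuse T f L R J μ ξ) {s t : ℝ} (hst : s < t)
    {K : Set X} (hK : IsClosed K) (hf : ∀ r ∈ Ioo s t, f r ∈ K) : L t ∈ K := by
  refine hK.mem_of_tendsto (h.left t) ?_
  filter_upwards [Ioo_mem_nhdsLT hst] with r hr using hf r hr

lemma IsJumpDiffuse.right_mem (h : IsJumpDiffuse T f L R J μ ξ) {s t : ℝ} (hst : s < t)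
    {K : Set X} (hK : IsClosed K) (hf : ∀ r ∈ Ioo s t, f r ∈ K) : R s ∈ K := by
  refine hK.mem_of_tendsto (h.right s) ?_
  filter_upwards [Ioo_mem_nhdsGT hst] with r hr using hf r hr

lemma IsJumpDiffuse.left_right_eq (h : IsJumpDiffuse T f L R J μ ξ) {t : ℝ} (ht : t ∈ Icc 0 T)
    (htJ : t ∉ J) : L t = f t ∧ R t = f t :=
  ⟨tendsto_nhds_unique (h.left t) ((h.continuousAt t ht htJ).tendsto.mono_left nhdsWithin_le_nhds),
    tendsto_nhds_unique (h.right t)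
      ((h.continuousAt t ht htJ).tendsto.mono_left nhdsWithin_le_nhds)⟩

lemma IsJumpDiffuse.continuousOn_energyDeriv (h : IsJumpDiffuse T f L R J μ ξ)
    (hE : IsEnergy T E) (hT : 0 < T) :
    ContinuousOn (fun r => energyDeriv T E (r, f r)) (Icc 0 T \ J) := by
  refine (hE.continuousOn_energyDeriv hT).comp (fun r hr => ?_) fun r hr => ⟨hr.1, mem_univ _⟩
  exact continuousWithinAt_id.prodMk (h.continuousAt r hr.1 hr.2).continuousWithinAt

lemma IsJumpDiffuse.norm_left_right_le (h : IsJumpDiffuse T f L R J μ ξ) {B : ℝ}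
    (hB : ∀ t, ‖f t‖ ≤ B) (t : ℝ) : ‖L t‖ ≤ B ∧ ‖R t‖ ≤ B :=
  ⟨le_of_tendsto (h.left t).norm (.of_forall hB), le_of_tendsto (h.right t).norm (.of_forall hB)⟩

variable [FiniteDimensional ℝ X]

lemma IsEnergy.exists_bound_energyDeriv (hE : IsEnergy T E) (hT : 0 < T) (B : ℝ) :
    ∃ C, 0 ≤ C ∧ ∀ r ∈ Icc 0 T, ∀ x, ‖x‖ ≤ B → ‖energyDeriv T E (r, x)‖ ≤ C := by
  have : ProperSpace X := FiniteDimensional.proper ℝ X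
  obtain ⟨C, hC⟩ := ((isCompact_Icc (a := (0 : ℝ)) (b := T)).prod
    (isCompact_closedBall (0 : X) B)).exists_bound_of_continuousOn
    ((hE.continuousOn_energyDeriv hT).mono (prod_mono_right (subset_univ _)))
  refine ⟨max C 0, le_max_right _ _, fun r hr x hx => (hC (r, x) ⟨hr, ?_⟩).trans (le_max_left _ _)⟩
  simpa using hx

/-- The differential along the curve is continuous off the countable set `J`, which an atomless
measure does not see. -/
lemma IsJumpDiffuse.aestronglyMeasurable_energyDeriv (h : IsJumpDiffuse T f L R J μ ξ)
    (hE : IsEnergy T E) (hT : 0 < T) (ν : Measure ℝ) [NullSingletonClass ν] :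
    AEStronglyMeasurable (fun r => energyDeriv T E (r, f r)) (ν.restrict (Icc 0 T)) := by
  have hJ : ν J = 0 := h.countable.measure_zero ν
  have hs : MeasurableSet (Icc 0 T \ J) := measurableSet_Icc.diff h.countable.measurableSet
  have h1 := (h.continuousOn_energyDeriv hE hT).aestronglyMeasurable (μ := ν) hs
  rwa [Measure.restrict_congr_set (sdiff_null_ae_eq_self hJ)] at h1

lemma IsJumpDiffuse.integrableOn_dtE (h : IsJumpDiffuse T f L R J μ ξ) (hE : IsEnergy T E)
    (hT : 0 < T) : IntegrableOn (fun r => dtE T E r (f r)) (Icc 0 T) := by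
  obtain ⟨B, hB⟩ := h.bounded
  obtain ⟨C, hC0, hC⟩ := hE.exists_bound_energyDeriv hT B
  have h1 : IntegrableOn (fun r => energyDeriv T E (r, f r) (1, 0)) (Icc 0 T) := by
    refine Integrable.mono' (g := fun _ => C * ‖((1 : ℝ), (0 : X))‖) (by simp) ?_ ?_
    · exact (ContinuousLinearMap.apply ℝ ℝ ((1 : ℝ), (0 : X))).continuous.comp_aestronglyMeasurable
        (h.aestronglyMeasurable_energyDeriv hE hT volume)
    · refine (ae_restrict_iff' measurableSet_Icc).2 (.of_forall fun r hr => ?_)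
      exact (ContinuousLinearMap.le_opNorm _ _).trans (by gcongr; exact hC r hr _ (hB r))
  exact h1.congr_fun (fun r hr => (hE.dtE_eq hT hr (f r)).symm) measurableSet_Icc

lemma IsJumpDiffuse.integrableOn_DE (h : IsJumpDiffuse T f L R J μ ξ) (hE : IsEnergy T E)
    (hT : 0 < T) : IntegrableOn (fun r => DE E r (f r) (ξ r)) (Icc 0 T) μ := by
  have := h.nullSingleton
  obtain ⟨B, hB⟩ := h.bounded
  obtain ⟨C, hC0, hC⟩ := hE.exists_bound_energyDeriv hT B
  have h1 : IntegrableOn (fun r => energyDeriv T E (r, f r) (0, ξ r)) (Icc 0 T) μ := by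
    refine Integrable.mono' (g := fun r => C * ‖ξ r‖) (h.integrable.norm.const_mul C).integrableOn
      ?_ ?_
    · exact isBoundedBilinearMap_apply.continuous.comp_aestronglyMeasurable
        ((h.aestronglyMeasurable_energyDeriv hE hT μ).prodMk
          (aestronglyMeasurable_const.prodMk h.integrable.1.restrict))
    · refine (ae_restrict_iff' measurableSet_Icc).2 (.of_forall fun r hr => ?_)
      refine (ContinuousLinearMap.le_opNorm _ _).trans ?_
      have : ‖((0 : ℝ), ξ r)‖ = ‖ξ r‖ := by simp [Prod.norm_def]
      rw [this]
      gcongr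
      exact hC r hr _ (hB r)
  exact h1.congr_fun (fun r hr => (hE.DE_apply hr (f r) (ξ r)).symm) measurableSet_Icc

lemma IsJumpDiffuse.summable_norm (h : IsJumpDiffuse T f L R J μ ξ) :
    Summable (J.indicator fun r => ‖R r - L r‖) := by
  have := summable_norm_iff.2 h.summable
  simpa only [norm_indicator_eq_indicator_norm] using this

/-- The differential is bounded on a ball containing all one-sided limits, so energy jumps are
dominated by a multiple of the jumps of the curve. -/
lemma IsJumpDiffuse.summable_energy (h : IsJumpDiffuse T f L R J μ ξ) (hE : IsEnergy T E)
    (hT : 0 < T) : Summable (J.indicator fun r => E r (R r) - E r (L r)) := by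
  obtain ⟨B, hB⟩ := h.bounded
  obtain ⟨C, hC0, hC⟩ := hE.exists_bound_energyDeriv hT B
  refine Summable.of_norm_bounded (h.summable_norm.mul_left C) fun r => ?_
  by_cases hr : r ∈ J
  · have hrT := h.subset hr
    simp only [hr, indicator_of_mem]
    have hL := (h.norm_left_right_le hB r).1
    have hR := (h.norm_left_right_le hB r).2
    refine Convex.norm_image_sub_le_of_norm_fderiv_le (𝕜 := ℝ) (s := Metric.closedBall 0 B)
      (fun x _ => (hE.contDiff_apply hrT).differentiable (by decide) x) (fun x hx => ?_)
      (convex_closedBall _ _) (by simpa using hL) (by simpa using hR)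
    refine ContinuousLinearMap.opNorm_le_bound _ hC0 fun v => ?_
    have h1 := hE.DE_apply hrT x v
    rw [DE] at h1
    rw [h1]
    refine (ContinuousLinearMap.le_opNorm _ _).trans ?_
    have : ‖((0 : ℝ), v)‖ = ‖v‖ := by simp [Prod.norm_def]
    rw [this]
    gcongr
    exact hC r hrT x (by simpa using hx)
  · simp [hr]

/-- On an interval where the differential of the energy is almost constant along the curve, the
chain rule holds up to a small multiple of the variation. -/
lemma IsJumpDiffuse.abs_defect_le (h : IsJumpDiffuse T f L R J μ ξ) (hE : IsEnergy T E)
    (hT : 0 < T) {s t ε : ℝ} (hs : 0 ≤ s) (hst : s < t) (ht : t ≤ T) (hε : 0 ≤ ε) {K : Set X}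
    (hK : IsClosed K) (hKc : Convex ℝ K) {A : ℝ × X →L[ℝ] ℝ}
    (hA : ∀ r ∈ Icc s t, ∀ x ∈ K, ‖energyDeriv T E (r, x) - A‖ ≤ ε)
    (hf : ∀ r ∈ Ioo s t, f r ∈ K) :
    |E t (L t) - E s (R s) - (∫ r in Ioo s t, dtE T E r (f r))
        - (∫ r in Ioo s t, DE E r (f r) (ξ r) ∂μ)
        - jumpSum J (Ioo s t) (fun r => E r (R r) - E r (L r))| ≤
      2 * ε * ((t - s) + (∫ r in Ioo s t, ‖ξ r‖ ∂μ)
        + jumpSum J (Ioo s t) (fun r => ‖R r - L r‖)) := by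
  have : CompleteSpace X := FiniteDimensional.complete ℝ X
  have hsT : Icc s t ⊆ Icc 0 T := Icc_subset_Icc hs ht
  have hoT : Ioo s t ⊆ Icc 0 T := Ioo_subset_Icc_self.trans hsT
  have hLK : ∀ r ∈ Ioc s t, L r ∈ K := fun r hr =>
    h.left_mem hr.1 hK fun q hq => hf q ⟨hq.1, hq.2.trans_le hr.2⟩
  have hRK : ∀ r ∈ Ico s t, R r ∈ K := fun r hr =>
    h.right_mem hr.2 hK fun q hq => hf q ⟨hr.1.trans_lt hq.1, hq.2⟩
  -- the mean value inequality
  have hmv : ∀ p ∈ Icc s t ×ˢ K, ∀ q ∈ Icc s t ×ˢ K,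
      ‖E q.1 q.2 - E p.1 p.2 - A (q - p)‖ ≤ ε * ‖q - p‖ := fun p hp q hq =>
    Convex.norm_image_sub_le_of_norm_hasFDerivWithin_le' (f := fun q : ℝ × X => E q.1 q.2)
      (fun x hx => (hE.hasFDerivWithinAt (q := x) ⟨hsT hx.1, mem_univ _⟩).mono
        (prod_mono hsT (subset_univ _)))
      (fun x hx => hA x.1 hx.1 x.2 hx.2) ((convex_Icc s t).prod hKc) hp hq
  set I := ∫ r in Ioo s t, ξ r ∂μ with hI
  set N := ∫ r in Ioo s t, ‖ξ r‖ ∂μ with hN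
  set S := jumpSum J (Ioo s t) (fun r => R r - L r) with hS
  set V := jumpSum J (Ioo s t) (fun r => ‖R r - L r‖) with hV
  have hsum1 := summable_indicator_inter h.summable (Ioo s t)
  have hsum2 := summable_indicator_inter h.summable_norm (Ioo s t)
  have hsum3 := summable_indicator_inter (h.summable_energy hE hT) (Ioo s t)
  have hIN : ‖I‖ ≤ N := norm_integral_le_integral_norm _
  have hSV : ‖S‖ ≤ V := norm_jumpSum_le h.summable_norm _
  have hN0 : 0 ≤ N := integral_nonneg fun _ => norm_nonneg _
  have hV0 : 0 ≤ V := jumpSum_nonneg fun _ => norm_nonneg _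
  have hinc : L t - R s = I + S := h.increment s t hs hst ht
  -- the increment of the energy
  have e1 : |E t (L t) - E s (R s) - A (t - s, L t - R s)| ≤ ε * ((t - s) + N + V) := by
    refine (hmv (s, R s) ⟨⟨le_rfl, hst.le⟩, hRK s ⟨le_rfl, hst⟩⟩ (t, L t)
      ⟨⟨hst.le, le_rfl⟩, hLK t ⟨hst, le_rfl⟩⟩).trans ?_
    refine mul_le_mul_of_nonneg_left ?_ hε
    simp only [Prod.mk_sub_mk, Prod.norm_def]
    rw [hinc, Real.norm_of_nonneg (by linarith)]
    have := norm_add_le I S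
    exact max_le (by linarith) (by linarith)
  -- the time integral
  have e2 : |(∫ r in Ioo s t, dtE T E r (f r)) - (t - s) * A (1, 0)| ≤ ε * (t - s) := by
    have hc : (t - s) * A (1, 0) = ∫ _ in Ioo s t, A (1, 0) := by
      simp [hst.le]
    rw [hc, ← integral_sub ((h.integrableOn_dtE hE hT).mono_set hoT) (by simp)]
    have := norm_setIntegral_le_of_norm_le_const (μ := volume) (s := Ioo s t) (C := ε)
      (f := fun r => dtE T E r (f r) - A (1, 0)) (by simp) (fun r hr => by
        rw [hE.dtE_eq hT (hoT hr), ← sub_apply]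
        refine (ContinuousLinearMap.le_opNorm _ _).trans ?_
        have h1 : ‖((1 : ℝ), (0 : X))‖ = 1 := by simp [Prod.norm_def]
        rw [h1, mul_one]
        exact hA r (Ioo_subset_Icc_self hr) _ (hf r hr))
    simpa [hst.le] using this
  -- the diffuse integral
  have e3 : |(∫ r in Ioo s t, DE E r (f r) (ξ r) ∂μ) - A (0, I)| ≤ ε * N := by
    have hξ : IntegrableOn ξ (Ioo s t) μ := h.integrable.integrableOn
    have hc : A (0, I) = ∫ r in Ioo s t, A (0, ξ r) ∂μ :=
      ((A.comp (ContinuousLinearMap.inr ℝ ℝ X)).integral_comp_comm hξ).symm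
    have hiA : IntegrableOn (fun r => A (0, ξ r)) (Ioo s t) μ :=
      (A.comp (ContinuousLinearMap.inr ℝ ℝ X)).integrable_comp hξ
    rw [hc, ← integral_sub ((h.integrableOn_DE hE hT).mono_set hoT) hiA, hN,
      ← integral_const_mul, ← Real.norm_eq_abs]
    refine norm_integral_le_of_norm_le (hξ.norm.const_mul ε) ?_
    refine (ae_restrict_iff' measurableSet_Ioo).2 (.of_forall fun r hr => ?_)
    rw [hE.DE_apply (hoT hr), ← sub_apply]
    refine (ContinuousLinearMap.le_opNorm _ _).trans ?_
    have h1 : ‖((0 : ℝ), ξ r)‖ = ‖ξ r‖ := by simp [Prod.norm_def]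
    rw [h1]
    gcongr
    exact hA r (Ioo_subset_Icc_self hr) _ (hf r hr)
  -- the jumps
  have e4 : |jumpSum J (Ioo s t) (fun r => E r (R r) - E r (L r)) - A (0, S)| ≤ ε * V := by
    have hc : A (0, S) = ∑' r, A (0, (J ∩ Ioo s t).indicator (fun r => R r - L r) r) :=
      (A.comp (ContinuousLinearMap.inr ℝ ℝ X)).map_tsum hsum1
    have hsA : Summable fun r => A (0, (J ∩ Ioo s t).indicator (fun r => R r - L r) r) :=
      (A.comp (ContinuousLinearMap.inr ℝ ℝ X)).summable hsum1
    rw [hc, jumpSum, ← hsum3.tsum_sub hsA, hV, jumpSum, ← tsum_mul_left,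
      ← Real.norm_eq_abs]
    refine tsum_of_norm_bounded (hsum2.mul_left ε).hasSum fun r => ?_
    by_cases hr : r ∈ J ∩ Ioo s t
    · simp only [hr, indicator_of_mem]
      have h1 := hmv (r, L r) ⟨Ioo_subset_Icc_self hr.2, hLK r ⟨hr.2.1, hr.2.2.le⟩⟩ (r, R r)
        ⟨Ioo_subset_Icc_self hr.2, hRK r ⟨hr.2.1.le, hr.2.2⟩⟩
      simpa [Prod.norm_def] using h1
    · simp [hr, show A (0, 0) = 0 from map_zero A]
  -- For the linear map `A` the chain rule is exact. The error of the energy increment and the sum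
  -- of the other three errors are each at most `ε` times the variation, whence the factor `2`.
  have hsplit : A (t - s, L t - R s) = (t - s) * A (1, 0) + A (0, I) + A (0, S) := by
    have : (t - s, L t - R s) = (t - s) • ((1 : ℝ), (0 : X)) + (0, I) + (0, S) := by
      simp [hinc]
    rw [this, map_add, map_add, map_smul, smul_eq_mul]
  rw [hsplit] at e1
  rw [abs_le] at e1 e2 e3 e4 ⊢
  constructor <;> linarith [e1.1, e1.2, e2.1, e2.2, e3.1, e3.2, e4.1, e4.2]

end ChainRule

/-! ### From local estimates to the global chain rule. -/

section EnergyChainRule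

variable {T : ℝ} {E : ℝ → X → ℝ} {f L R : ℝ → X} {J : Set ℝ} {μ : Measure ℝ} {ξ : ℝ → X}

/-- Continuity of the differential on a closed ball. Closedness keeps the one-sided limits of the
curve in `K`, and convexity serves the mean value inequality. -/
lemma IsEnergy.exists_convex_nhd (hE : IsEnergy T E) (hT : 0 < T) {t : ℝ} (ht : t ∈ Icc 0 T)
    (x : X) {ε : ℝ} (hε : 0 < ε) : ∃ δ > 0, ∃ K ∈ 𝓝 x, IsClosed K ∧ Convex ℝ K ∧
      ∀ r ∈ Icc 0 T, |r - t| < δ → ∀ y ∈ K,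
        ‖energyDeriv T E (r, y) - energyDeriv T E (t, x)‖ ≤ ε := by
  have h := Metric.continuousWithinAt_iff.1
    (hE.continuousOn_energyDeriv hT (t, x) ⟨ht, mem_univ _⟩) ε hε
  obtain ⟨δ, hδ, h⟩ := h
  refine ⟨δ, hδ, Metric.closedBall x (δ / 2), Metric.closedBall_mem_nhds _ (half_pos hδ),
    Metric.isClosed_closedBall, convex_closedBall _ _, fun r hr hrt y hy => ?_⟩
  rw [← dist_eq_norm]
  refine (h (x := (r, y)) ⟨hr, mem_univ _⟩ ?_).le
  rw [Prod.dist_eq]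
  exact max_lt (by simpa [Real.dist_eq] using hrt)
    ((Metric.mem_closedBall.1 hy).trans_lt (half_lt_self hδ))

variable [FiniteDimensional ℝ X]

/-- The chain rule for the energy along a curve of bounded variation. -/
theorem IsJumpDiffuse.chain_rule (h : IsJumpDiffuse T f L R J μ ξ) (hE : IsEnergy T E)
    (hT : 0 < T) {t : ℝ} (ht : t ∈ Ioc 0 T) :
    E t (L t) - E 0 (R 0) = (∫ r in Ioo 0 t, dtE T E r (f r))
      + (∫ r in Ioo 0 t, DE E r (f r) (ξ r) ∂μ)
      + jumpSum J (Ioo 0 t) fun r => E r (R r) - E r (L r) := by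
  have := h.nullSingleton
  have hk := h.summable_energy hE hT
  have hn := h.summable_norm
  set k : ℝ → ℝ := fun r => E r (R r) - E r (L r) with hkdef
  set n : ℝ → ℝ := fun r => ‖R r - L r‖ with hndef
  have hk0 : ∀ t ∈ Icc 0 T, t ∉ J → k t = 0 := fun t ht hJ => by
    simp [hkdef, (h.left_right_eq ht hJ).1, (h.left_right_eq ht hJ).2]
  have hn0 : ∀ t ∈ Icc 0 T, t ∉ J → n t = 0 := fun t ht hJ => by
    simp [hndef, (h.left_right_eq ht hJ).1, (h.left_right_eq ht hJ).2]
  -- `Φ` is the defect of the chain rule, written with right limits and half-open intervals so that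
  -- its increments are additive. In an increment the jump at the right end turns `E t (R t)` into
  -- `E t (L t)`.
  set Φ : ℝ → ℝ := fun t => E t (R t) - (∫ r in Ioc 0 t, dtE T E r (f r))
    - (∫ r in Ioc 0 t, DE E r (f r) (ξ r) ∂μ) - jumpSum J (Ioc 0 t) k with hΦ
  set M : ℝ → ℝ := fun t => 2 * (t + (∫ r in Ioc 0 t, ‖ξ r‖ ∂μ) + jumpSum J (Ioc 0 t) n) with hM
  have hadd : ∀ {ν : Measure ℝ} [NullSingletonClass ν] {g : ℝ → ℝ}, IntegrableOn g (Icc 0 T) ν →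
      ∀ {s t}, 0 ≤ s → s ≤ t → t ≤ T →
        ∫ r in Ioc 0 t, g r ∂ν = ∫ r in Ioc 0 s, g r ∂ν + ∫ r in Ioo s t, g r ∂ν := by
    intro ν _ g hg s t hs hst ht
    rw [← integral_Ioc_eq_integral_Ioo, ← Ioc_union_Ioc_eq_Ioc hs hst]
    refine setIntegral_union (Ioc_disjoint_Ioc_of_le le_rfl) measurableSet_Ioc (hg.mono_set ?_)
      (hg.mono_set ?_)
    · exact fun r hr => ⟨hr.1.le, hr.2.trans (hst.trans ht)⟩
    · exact fun r hr => ⟨hs.trans hr.1.le, hr.2.trans ht⟩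
  have hΦsub : ∀ {s t}, 0 ≤ s → s < t → t ≤ T → Φ t - Φ s =
      E t (L t) - E s (R s) - (∫ r in Ioo s t, dtE T E r (f r))
        - (∫ r in Ioo s t, DE E r (f r) (ξ r) ∂μ) - jumpSum J (Ioo s t) k := by
    intro s t hs hst ht
    simp only [hΦ]
    rw [hadd (h.integrableOn_dtE hE hT) hs hst.le ht, hadd (h.integrableOn_DE hE hT) hs hst.le ht,
      jumpSum_Ioc_add hk hs hst.le,
      jumpSum_Ioc_eq hk hst (hk0 t ⟨hs.trans hst.le, ht⟩)]
    simp only [hkdef]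
    ring
  have hMsub : ∀ {s t}, 0 ≤ s → s < t → t ≤ T → M t - M s =
      2 * ((t - s) + (∫ r in Ioo s t, ‖ξ r‖ ∂μ) + jumpSum J (Ioo s t) n + n t) := by
    intro s t hs hst ht
    simp only [hM]
    rw [hadd h.integrable.norm.integrableOn hs hst.le ht, jumpSum_Ioc_add hn hs hst.le,
      jumpSum_Ioc_eq hn hst (hn0 t ⟨hs.trans hst.le, ht⟩)]
    ring
  have hnn : ∀ r, 0 ≤ n r := fun r => norm_nonneg _
  have hMmono : MonotoneOn M (Icc 0 T) := by
    intro s hs t ht hst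
    rcases hst.eq_or_lt with rfl | hst
    · exact le_rfl
    · have h1 := hMsub hs.1 hst ht.2
      have h2 : 0 ≤ ∫ r in Ioo s t, ‖ξ r‖ ∂μ := integral_nonneg fun _ => norm_nonneg _
      have h3 : 0 ≤ jumpSum J (Ioo s t) n := jumpSum_nonneg hnn
      have h4 := hnn t
      linarith
  have hest : ∀ ε > 0, ∀ s t, 0 ≤ s → s < t → t ≤ T → ∀ (K : Set X) (A : ℝ × X →L[ℝ] ℝ),
      IsClosed K → Convex ℝ K → (∀ r ∈ Icc s t, ∀ x ∈ K, ‖energyDeriv T E (r, x) - A‖ ≤ ε) →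
      (∀ r ∈ Ioo s t, f r ∈ K) → |Φ t - Φ s| ≤ ε * |M t - M s| := by
    intro ε hε s t hs hst ht K A hK hKc hA hf
    rw [hΦsub hs hst ht, abs_of_nonneg (sub_nonneg.2 (hMmono ⟨hs, hst.le.trans ht⟩
      ⟨hs.trans hst.le, ht⟩ hst.le)), hMsub hs hst ht]
    refine (h.abs_defect_le hE hT hs hst ht hε.le hK hKc hA hf).trans ?_
    have h1 : 0 ≤ ε * n t := mul_nonneg hε.le (hnn t)
    simp only [hndef] at h1 ⊢
    linarith
  have hconst : Φ t = Φ 0 := by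
    refine eq_of_local_of_monotoneOn hT.le hMmono (fun ε hε t ht => ?_) ⟨ht.1.le, ht.2⟩
    -- Two neighbourhoods are needed: before `t` the curve is near `L t`, after `t` near `R t`, and
    -- these may differ.
    obtain ⟨δ₁, hδ₁, K₁, hK₁, hc₁, hv₁, hA₁⟩ := hE.exists_convex_nhd hT ht (L t) hε
    obtain ⟨δ₂, hδ₂, K₂, hK₂, hc₂, hv₂, hA₂⟩ := hE.exists_convex_nhd hT ht (R t) hε
    obtain ⟨l, hl, hl'⟩ := (mem_nhdsLT_iff_exists_Ioo_subset).1 ((h.left t) hK₁)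
    obtain ⟨m, hm, hm'⟩ := (mem_nhdsGT_iff_exists_Ioo_subset).1 ((h.right t) hK₂)
    rw [mem_Iio] at hl
    rw [mem_Ioi] at hm
    refine ⟨min (min δ₁ δ₂) (min (t - l) (m - t)), by
      simp only [gt_iff_lt, lt_min_iff]; exact ⟨⟨hδ₁, hδ₂⟩, by linarith, by linarith⟩,
      fun s hs hst => ?_⟩
    simp only [lt_min_iff] at hst
    obtain ⟨⟨hs1, hs2⟩, hs3, hs4⟩ := hst
    rw [abs_sub_lt_iff] at hs3 hs4
    rcases lt_trichotomy s t with hlt | rfl | hlt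
    · rw [abs_sub_comm (Φ s), abs_sub_comm (M s)]
      refine hest ε hε s t hs.1 hlt ht.2 K₁ (energyDeriv T E (t, L t)) hc₁ hv₁ (fun r hr x hx => ?_) fun r hr => ?_
      · refine hA₁ r ⟨hs.1.trans hr.1, hr.2.trans ht.2⟩ (lt_of_le_of_lt ?_ hs1) x hx
        rw [abs_sub_comm, abs_sub_comm s, abs_of_nonneg (by linarith [hr.2]),
          abs_of_nonneg (by linarith)]
        linarith [hr.1]
      · exact hl' ⟨by linarith [hr.1], hr.2⟩
    · simp
    · refine hest ε hε t s ht.1 hlt hs.2 K₂ (energyDeriv T E (t, R t)) hc₂ hv₂ (fun r hr x hx => ?_) fun r hr => ?_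
      · refine hA₂ r ⟨ht.1.trans hr.1, hr.2.trans hs.2⟩ (lt_of_le_of_lt ?_ hs2) x hx
        rw [abs_of_nonneg (by linarith [hr.1]), abs_of_nonneg (by linarith)]
        linarith [hr.2]
      · exact hm' ⟨hr.1, by linarith [hr.2]⟩
  have := hΦsub le_rfl ht.1 ht.2
  linarith

end EnergyChainRule

/-! ### The decomposition of the derivative of a curve of bounded variation -/

section Decomposition

variable {T : ℝ} {u : ℝ → X}

lemma extendEnds_eq {Y : Type*} {u : ℝ → Y} {t : ℝ} (ht : t ∈ Icc 0 T) : extendEnds T u t = u t := by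
  simp [extendEnds, ht.1, ht.2]

lemma leftVal_zero {Y : Type*} [NormedAddCommGroup Y] {u : ℝ → Y} :
    leftVal T u 0 = extendEnds T u 0 := by
  refine leftLim_eq_of_tendsto (tendsto_const_nhds.congr' ?_)
  filter_upwards [self_mem_nhdsWithin] with s hs
  have : min T s ≤ 0 := (min_le_right _ _).trans (le_of_lt hs)
  have : min T 0 ≤ 0 := min_le_right _ _
  simp [extendEnds, *]

lemma rightVal_end {Y : Type*} [NormedAddCommGroup Y] {u : ℝ → Y} :
    rightVal T u T = extendEnds T u T := by
  refine rightLim_eq_of_tendsto (tendsto_const_nhds.congr' ?_)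
  filter_upwards [self_mem_nhdsWithin] with s hs
  have : min T s = T := min_eq_left (le_of_lt hs)
  simp [extendEnds, this]

lemma essJumpSet_subset {Y : Type*} [NormedAddCommGroup Y] {u : ℝ → Y} :
    essJumpSet T u ⊆ jumpSet T u := fun t ht => by
  refine ⟨ht.1, ?_⟩
  by_contra hcon
  rw [not_or, not_not, not_not] at hcon
  exact ht.2 (hcon.1.trans hcon.2)

/-- For a non-integrable density the vector measure is `0` by default, so no integrability of `deriv
u` has to be known for the absolutely continuous part. -/
lemma withDensityᵥ_apply_of_null {α : Type*} [MeasurableSpace α] {Y : Type*} [NormedAddCommGroup Y]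
    [NormedSpace ℝ Y] {μ : Measure α} {f : α → Y} {s : Set α} (hs : MeasurableSet s)
    (h : μ s = 0) : μ.withDensityᵥ f s = 0 := by
  by_cases hf : Integrable f μ
  · rw [withDensityᵥ_apply hf hs, Measure.restrict_eq_zero.2 h, integral_zero_measure]
  · simp [Measure.withDensityᵥ, hf]

lemma acPart_apply_of_null {s : Set ℝ} (hs : MeasurableSet s)
    (h : volume.restrict (Ioo 0 T) s = 0) : acPart T u s = 0 :=
  withDensityᵥ_apply_of_null hs h

variable [FiniteDimensional ℝ X]

lemma tendsto_leftVal (hf : BoundedVariationOn (extendEnds T u) univ) (t : ℝ) :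
    Tendsto (extendEnds T u) (𝓝[<] t) (𝓝 (leftVal T u t)) :=
  have : CompleteSpace X := FiniteDimensional.complete ℝ X
  hf.tendsto_leftLim t

lemma tendsto_rightVal (hf : BoundedVariationOn (extendEnds T u) univ) (t : ℝ) :
    Tendsto (extendEnds T u) (𝓝[>] t) (𝓝 (rightVal T u t)) :=
  have : CompleteSpace X := FiniteDimensional.complete ℝ X
  hf.tendsto_rightLim t

lemma continuousAt_of_notMem_jumpSet (hf : BoundedVariationOn (extendEnds T u) univ) {t : ℝ}
    (ht : t ∈ Icc 0 T) (htJ : t ∉ jumpSet T u) : ContinuousAt (extendEnds T u) t := by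
  have h : leftVal T u t = u t ∧ u t = rightVal T u t := by
    by_contra hcon
    exact htJ ⟨ht, not_and_or.1 hcon⟩
  rw [continuousAt_iff_continuous_left'_right', ContinuousWithinAt, ContinuousWithinAt,
    extendEnds_eq ht]
  refine ⟨?_, ?_⟩
  · have := tendsto_leftVal hf t
    rwa [h.1] at this
  · have := tendsto_rightVal hf t
    rwa [← h.2] at this

lemma leftVal_eq_of_continuousAt (hf : BoundedVariationOn (extendEnds T u) univ) {t : ℝ}
    (h : ContinuousAt (extendEnds T u) t) :
    leftVal T u t = extendEnds T u t ∧ rightVal T u t = extendEnds T u t :=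
  ⟨tendsto_nhds_unique (tendsto_leftVal hf t) (h.tendsto.mono_left nhdsWithin_le_nhds),
    tendsto_nhds_unique (tendsto_rightVal hf t) (h.tendsto.mono_left nhdsWithin_le_nhds)⟩

lemma countable_jumpSet (hf : BoundedVariationOn (extendEnds T u) univ) :
    (jumpSet T u).Countable := by
  refine (countable_not_continuousAt hf).mono ?_
  intro t ht
  rw [mem_ofPred_eq]
  intro hc
  have h := leftVal_eq_of_continuousAt hf hc
  rw [extendEnds_eq ht.1] at h
  rcases ht.2 with h1 | h1
  · exact h1 h.1
  · exact h1 h.2.symm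

lemma measurableSet_essJumpSet (hf : BoundedVariationOn (extendEnds T u) univ) :
    MeasurableSet (essJumpSet T u) :=
  ((countable_jumpSet hf).mono essJumpSet_subset).measurableSet

/-- All that is used of the derivative measure `D` of the extended curve: its values on open
intervals and points, and the removal of its atoms at the essential jumps inside `(0,T)`. -/
lemma exists_diffusePart_apply (hf : BoundedVariationOn (extendEnds T u) univ) :
    ∃ D : VectorMeasure ℝ X,
      (∀ s t, s < t → D (Ioo s t) = leftVal T u t - rightVal T u s) ∧
      (∀ t, D {t} = rightVal T u t - leftVal T u t) ∧
      ∀ A, MeasurableSet A →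
        diffusePart T u A = D (A ∩ Ioo 0 T) - D (A ∩ essJumpSet T u ∩ Ioo 0 T) := by
  have : CompleteSpace X := FiniteDimensional.complete ℝ X
  refine ⟨hf.vectorMeasure, fun s t hst => hf.vectorMeasure_Ioo hst,
    fun t => hf.vectorMeasure_singleton, fun A hA => ?_⟩
  have hJ := measurableSet_essJumpSet hf
  rw [diffusePart, sub_apply, jumpPart, VectorMeasure.restrict_apply _ hJ hA, distDeriv,
    dif_pos hf, VectorMeasure.restrict_apply _ measurableSet_Ioo hA,
    VectorMeasure.restrict_apply _ measurableSet_Ioo (hA.inter hJ)]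

lemma diffusePart_singleton (hf : BoundedVariationOn (extendEnds T u) univ) (t : ℝ) :
    diffusePart T u {t} = 0 := by
  obtain ⟨D, -, hD, hdiff⟩ := exists_diffusePart_apply hf
  rw [hdiff _ (measurableSet_singleton t)]
  by_cases ht : t ∈ essJumpSet T u
  · rw [inter_eq_left.2 (singleton_subset_iff.2 ht), sub_self]
  · rw [singleton_inter_eq_empty.2 ht, empty_inter, VectorMeasure.empty, sub_zero]
    by_cases ht' : t ∈ Ioo 0 T
    · rw [inter_eq_left.2 (singleton_subset_iff.2 ht'), hD, sub_eq_zero]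
      by_contra hne
      exact ht ⟨Ioo_subset_Icc_self ht', fun h => hne h.symm⟩
    · rw [singleton_inter_eq_empty.2 ht', VectorMeasure.empty]

lemma refMeasure_singleton (hf : BoundedVariationOn (extendEnds T u) univ) (t : ℝ) :
    refMeasure T u {t} = 0 := by
  rw [refMeasure, Measure.add_apply, measure_singleton, zero_add,
    VectorMeasure.variation_apply_eq_zero (measurableSet_singleton t)]
  intro s hs _
  rcases subset_singleton_iff_eq.1 hs with rfl | rfl
  · exact VectorMeasure.empty _
  · rw [cantorPart, sub_apply, diffusePart_singleton hf,
      acPart_apply_of_null (measurableSet_singleton t) (measure_singleton t), sub_zero]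

instance : IsFiniteMeasure (refMeasure T u) := by
  unfold refMeasure
  infer_instance

/-- The defining property of the density of the diffuse part. -/
lemma diffuseDensity_spec : StronglyMeasurable (diffuseDensity T u) ∧
    Integrable (diffuseDensity T u) (refMeasure T u) ∧
    (refMeasure T u).withDensityᵥ (diffuseDensity T u) = diffusePart T u := by
  -- A `μ`-null set is null for Lebesgue measure on `(0,T)` and for `|u'_C|`, hence for both parts
  -- of `u'_co`.
  have h := exists_withDensityᵥ_eq (diffusePart T u) (refMeasure T u) fun s hs h0 => by
    rw [refMeasure, Measure.add_apply, add_eq_zero] at h0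
    have h1 : cantorPart T u s = 0 := by
      have := VectorMeasure.enorm_measure_le_variation (cantorPart T u) s
      rwa [h0.2, nonpos_iff_eq_zero, enorm_eq_zero] at this
    rwa [cantorPart, sub_apply, acPart_apply_of_null hs h0.1, sub_zero] at h1
  rw [diffuseDensity, density, dif_pos h]
  exact h.choose_spec

/-- A curve of bounded variation splits into its diffuse part and its jumps. -/
theorem isJumpDiffuse_extendEnds (hf : BoundedVariationOn (extendEnds T u) univ) :
    IsJumpDiffuse T (extendEnds T u) (leftVal T u) (rightVal T u) (jumpSet T u) (refMeasure T u)
      (diffuseDensity T u) := by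
  have : CompleteSpace X := FiniteDimensional.complete ℝ X
  obtain ⟨D, hD, hD', hdiff⟩ := exists_diffusePart_apply hf
  have hJ := countable_jumpSet hf
  refine ⟨tendsto_leftVal hf, tendsto_rightVal hf, ?_, hJ, fun t ht => ht.1,
    fun t ht htJ => continuousAt_of_notMem_jumpSet hf ht htJ, ?_, diffuseDensity_spec.2.1,
    ⟨refMeasure_singleton hf⟩, ?_⟩
  · refine ⟨‖extendEnds T u 0‖ + (eVariationOn (extendEnds T u) univ).toReal, fun t => ?_⟩
    have h1 := hf.dist_le (mem_univ t) (mem_univ 0)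
    have h2 := norm_le_norm_add_norm_sub' (extendEnds T u t) (extendEnds T u 0)
    rw [dist_eq_norm] at h1
    linarith
  · have := (hasSum_singleton_of_countable D hJ).summable
    simp only [hD'] at this
    exact summable_subtype_iff_indicator.1 this
  · intro s t hs hst ht
    have hsub : Ioo s t ⊆ Ioo 0 T := Ioo_subset_Ioo hs ht
    have hess : (Ioo s t ∩ essJumpSet T u).Countable :=
      hJ.mono (inter_subset_right.trans essJumpSet_subset)
    have h1 : D (Ioo s t ∩ essJumpSet T u) =
        jumpSum (jumpSet T u) (Ioo s t) fun r => rightVal T u r - leftVal T u r := by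
      rw [← (hasSum_singleton_of_countable D hess).tsum_eq]
      simp only [hD']
      rw [tsum_subtype (Ioo s t ∩ essJumpSet T u) fun r => rightVal T u r - leftVal T u r, jumpSum]
      congr 1
      funext r
      by_cases hr : r ∈ Ioo s t ∩ essJumpSet T u
      · rw [indicator_of_mem hr,
          indicator_of_mem (show r ∈ jumpSet T u ∩ Ioo s t from ⟨essJumpSet_subset hr.2, hr.1⟩)]
      · rw [indicator_of_notMem hr]
        by_cases hr' : r ∈ jumpSet T u ∩ Ioo s t
        · rw [indicator_of_mem hr', eq_comm, sub_eq_zero]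
          by_contra hne
          exact hr ⟨hr'.2, ⟨hr'.1.1, fun h => hne h.symm⟩⟩
        · rw [indicator_of_notMem hr']
    have h2 := hdiff (Ioo s t) measurableSet_Ioo
    rw [inter_eq_left.2 hsub, inter_eq_left.2 (inter_subset_left.trans hsub), hD s t hst,
      ← diffuseDensity_spec.2.2, withDensityᵥ_apply diffuseDensity_spec.2.1 measurableSet_Ioo,
      h1] at h2
    rw [h2, sub_add_cancel]

end Decomposition

/-! ### The gauge and its subdifferential -/

section Gauge

variable {Ψ₀ : X → ℝ}

lemma IsGauge.zero (h : IsGauge Ψ₀) : Ψ₀ 0 = 0 := by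
  simpa using h.smul 0 0 le_rfl

lemma IsGauge.continuous [FiniteDimensional ℝ X] (h : IsGauge Ψ₀) : Continuous Ψ₀ := by
  have hc : ConvexOn ℝ univ Ψ₀ := by
    refine ⟨convex_univ, fun x _ y _ a b ha hb _ => ?_⟩
    simpa only [h.smul _ _ ha, h.smul _ _ hb, smul_eq_mul] using h.add_le (a • x) (b • y)
  exact hc.locallyLipschitz.continuous

/-- The subgradient inequality is tested at `v + z`, `2v` and `0`; subadditivity and homogeneity do
the rest. -/
lemma IsGauge.mem_subdiff_iff (h : IsGauge Ψ₀) {v : X} {w : X →L[ℝ] ℝ} :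
    w ∈ subdiff Ψ₀ v ↔ w ∈ stableSet Ψ₀ ∧ w v = Ψ₀ v := by
  constructor
  · intro hw
    refine ⟨fun z => ?_, le_antisymm ?_ ?_⟩
    · have h1 := hw (v + z)
      rw [add_sub_cancel_left] at h1
      have h2 := h.add_le v z
      linarith
    · have h1 := hw (v + v)
      rw [add_sub_cancel_left] at h1
      have h2 := h.add_le v v
      linarith
    · have h1 := hw 0
      rw [zero_sub, map_neg, h.zero] at h1
      linarith
  · rintro ⟨hw, hv⟩ z
    rw [map_sub, hv]
    linarith [hw z]

lemma IsGauge.exists_subdiff_iff (h : IsGauge Ψ₀) {v : X} {w : X →L[ℝ] ℝ} :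
    (∃ ξ ∈ subdiff Ψ₀ v, ξ + w = 0) ↔ -w ∈ stableSet Ψ₀ ∧ (-w) v = Ψ₀ v := by
  rw [← h.mem_subdiff_iff]
  constructor
  · rintro ⟨ξ, hξ, h0⟩
    rwa [← eq_neg_of_add_eq_zero_left h0]
  · intro hw
    exact ⟨-w, hw, neg_add_cancel w⟩

end Gauge

/-! ### Extended real identities -/

/-- The identity forces `V` to be finite. The inequality `a ≤ b` is kept separately because
`ENNReal.ofReal` truncates negative numbers to `0`. -/
lemma coe_ennreal_add_coe_eq_iff {V : ℝ≥0∞} {a b : ℝ} :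
    (V : EReal) + (a : EReal) = (b : EReal) ↔ V = ENNReal.ofReal (b - a) ∧ a ≤ b := by
  induction V with
  | top => simp
  | coe V =>
    have h1 : (((V : ℝ≥0∞) : EReal)) = ((V : ℝ) : EReal) := rfl
    rw [h1, ← EReal.coe_add, EReal.coe_eq_coe_iff]
    constructor
    · intro h
      have h2 : b - a = (V : ℝ) := by linarith
      refine ⟨?_, by linarith [V.2, show (V : ℝ) = V.1 from rfl]⟩
      rw [h2, ENNReal.ofReal_coe_nnreal]
    · rintro ⟨h, hab⟩
      have h2 := congrArg ENNReal.toReal h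
      rw [ENNReal.coe_toReal, ENNReal.toReal_ofReal (by linarith)] at h2
      linarith

/-! ### Equality of energy drop and transition cost. -/

section Drop

variable {Ψ Ψ₀ : X → ℝ} {E : ℝ → X → ℝ} {t : ℝ}

lemma dropEqCost_iff {x y : X} : DropEqCost Ψ E t x y ↔
    finslerCost Ψ E t x y = ENNReal.ofReal (E t x - E t y) ∧ E t y ≤ E t x := by
  rw [DropEqCost]
  generalize finslerCost Ψ E t x y = V
  rw [← coe_ennreal_add_coe_eq_iff]
  induction V with
  | top => simp [-EReal.coe_sub]
  | coe V =>
    have h1 : (((V : ℝ≥0∞) : EReal)) = ((V : ℝ) : EReal) := rfl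
    rw [h1, ← EReal.coe_add, EReal.coe_eq_coe_iff, ← EReal.coe_neg, EReal.coe_eq_coe_iff]
    constructor <;> intro h <;> linarith

/-- Each cost is at least its energy drop, while the two costs together are at most the total drop,
so both are equal to their drops. The direct cost lies between the total drop and the sum by the
triangle inequality. -/
lemma dropEqCost_of_add_le [FiniteDimensional ℝ X] (hΨ : IsViscousPotential Ψ Ψ₀)
    (hE : ContDiff ℝ 1 (E t)) {x y z : X}
    (hfin : finslerCost Ψ E t x y + finslerCost Ψ E t y z ≠ ∞)
    (h : (finslerCost Ψ E t x y + finslerCost Ψ E t y z).toReal ≤ E t x - E t z) :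
    DropEqCost Ψ E t x y ∧ DropEqCost Ψ E t y z ∧ DropEqCost Ψ E t x z := by
  obtain ⟨h1, h2⟩ := ENNReal.add_ne_top.1 hfin
  have h3 : finslerCost Ψ E t x z ≠ ∞ := ne_top_of_le_ne_top hfin (finslerCost_triangle x y z)
  have low : ∀ {x y : X}, finslerCost Ψ E t x y ≠ ∞ →
      E t x - E t y ≤ (finslerCost Ψ E t x y).toReal := fun {x y} hxy =>
    (ENNReal.ofReal_le_iff_le_toReal hxy).1 (ofReal_sub_le_finslerCost hΨ hE x y)
  have key : ∀ {x y : X}, finslerCost Ψ E t x y ≠ ∞ →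
      (finslerCost Ψ E t x y).toReal ≤ E t x - E t y → DropEqCost Ψ E t x y :=
    fun {x y} hxy hle => by
      refine dropEqCost_iff.2 ⟨?_, by linarith [ENNReal.toReal_nonneg.trans hle]⟩
      rw [← le_antisymm hle (low hxy), ENNReal.ofReal_toReal hxy]
  have htri := ENNReal.toReal_mono hfin (finslerCost_triangle (Ψ := Ψ) (E := E) (t := t) x y z)
  rw [ENNReal.toReal_add h1 h2] at h htri
  have l1 := low h1
  have l2 := low h2
  exact ⟨key h1 (by linarith), key h2 (by linarith), key h3 (by linarith)⟩

lemma dropEqCost_self [FiniteDimensional ℝ X] (hΨ : IsViscousPotential Ψ Ψ₀) (x : X) :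
    DropEqCost Ψ E t x x :=
  dropEqCost_iff.2 ⟨by simp [finslerCost_self hΨ], le_rfl⟩

end Drop

/-! ### Stability and the chain rule along a curve of bounded variation -/

section Curve

variable [FiniteDimensional ℝ X] {T : ℝ} {u : ℝ → X} {E : ℝ → X → ℝ} {Ψ Ψ₀ : X → ℝ}

/-- Local stability at almost every time extends to all continuity points. -/
lemma stable_of_ae_stable (hT : 0 < T) (hE : IsEnergy T E)
    (hf : BoundedVariationOn (extendEnds T u) univ)
    (hs : ∀ᵐ t ∂(volume.restrict (Icc 0 T \ jumpSet T u)), -DE E t (u t) ∈ stableSet Ψ₀)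
    {t : ℝ} (ht : t ∈ Ioo 0 T) (htJ : t ∉ jumpSet T u) : -DE E t (u t) ∈ stableSet Ψ₀ := by
  intro z
  have hJ := countable_jumpSet hf
  set S := Icc 0 T \ jumpSet T u with hS
  have hSm : MeasurableSet S := measurableSet_Icc.diff hJ.measurableSet
  set G := {r ∈ S | -DE E r (u r) ∈ stableSet Ψ₀} with hG
  rw [ae_restrict_iff' hSm] at hs
  -- The stable continuity times have full measure in `(0,T)`, so they accumulate at `t`, and the
  -- closed stability condition passes to the limit along them.
  have hGae : ∀ᵐ r, r ∈ Ioo 0 T → r ∈ G := by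
    filter_upwards [hs, hJ.ae_notMem volume] with r hr hrJ hrT
    have hrS : r ∈ S := ⟨Ioo_subset_Icc_self hrT, hrJ⟩
    exact ⟨hrS, hr hrS⟩
  have hGS : G ⊆ S := fun r hr => hr.1
  have htG : t ∈ closure G := by
    rw [mem_closure_iff]
    intro o ho hto
    have hpos : 0 < volume (o ∩ Ioo 0 T) := (ho.inter isOpen_Ioo).measure_pos _ ⟨t, hto, ht⟩
    by_contra hemp
    refine hpos.ne' (measure_mono_null ?_ hGae)
    intro r hr hmem
    exact hemp ⟨r, hr.1, hmem hr.2⟩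
  have : (𝓝[G] t).NeBot := mem_closure_iff_nhdsWithin_neBot.1 htG
  have hcont := (isJumpDiffuse_extendEnds hf).continuousOn_energyDeriv hE hT t
    ⟨Ioo_subset_Icc_self ht, htJ⟩
  have hlim : Tendsto (fun r => -(energyDeriv T E (r, extendEnds T u r) (0, z))) (𝓝[G] t)
      (𝓝 (-(energyDeriv T E (t, extendEnds T u t) (0, z)))) :=
    (((ContinuousLinearMap.apply ℝ ℝ ((0 : ℝ), z)).continuous.tendsto _).comp
      (hcont.mono hGS).tendsto).neg
  have hval : ∀ r ∈ Icc 0 T, -(energyDeriv T E (r, extendEnds T u r) (0, z)) =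
      (-DE E r (u r)) z := fun r hr => by
    rw [extendEnds_eq hr, neg_apply, hE.DE_apply hr]
  rw [← hval t (Ioo_subset_Icc_self ht)]
  refine le_of_tendsto hlim ?_
  filter_upwards [self_mem_nhdsWithin] with r hr
  rw [hval r (hGS hr).1]
  exact hr.2 z

/-- The energy drop along a curve of bounded variation. -/
lemma energy_drop (hT : 0 < T) (hE : IsEnergy T E)
    (hf : BoundedVariationOn (extendEnds T u) univ) {t : ℝ} (ht : t ∈ Ioc 0 T) :
    IntegrableOn (fun r => (-DE E r (u r)) (diffuseDensity T u r)) (Ioo 0 t) (refMeasure T u) ∧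
    Summable (fun r : ↥(jumpSet T u ∩ Ioo 0 t) => E r (leftVal T u r) - E r (rightVal T u r)) ∧
    E 0 (rightVal T u 0) + (∫ s in (0 : ℝ)..t, dtE T E s (u s)) - E t (leftVal T u t) =
      (∫ r in Ioo 0 t, (-DE E r (u r)) (diffuseDensity T u r) ∂(refMeasure T u)) +
      ∑' r : ↥(jumpSet T u ∩ Ioo 0 t), (E r (leftVal T u r) - E r (rightVal T u r)) := by
  have h := isJumpDiffuse_extendEnds hf
  have hsub : Ioo 0 t ⊆ Icc 0 T := fun r hr => ⟨hr.1.le, hr.2.le.trans ht.2⟩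
  have hi := ((h.integrableOn_DE hE hT).mono_set hsub).neg
  have hcongr : EqOn (-fun r => DE E r (extendEnds T u r) (diffuseDensity T u r))
      (fun r => (-DE E r (u r)) (diffuseDensity T u r)) (Ioo 0 t) := fun r hr => by
    simp [extendEnds_eq (hsub hr)]
  have hk := summable_indicator_inter (h.summable_energy hE hT) (Ioo 0 t)
  have hk' : Summable ((jumpSet T u ∩ Ioo 0 t).indicator
      fun r => E r (leftVal T u r) - E r (rightVal T u r)) := by
    refine hk.neg.congr fun r => ?_
    by_cases hr : r ∈ jumpSet T u ∩ Ioo 0 t <;> simp [hr]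
  refine ⟨IntegrableOn.congr_fun hi hcongr measurableSet_Ioo,
    summable_subtype_iff_indicator.2 hk', ?_⟩
  rw [tsum_subtype (jumpSet T u ∩ Ioo 0 t) fun r => E r (leftVal T u r) - E r (rightVal T u r),
    ← setIntegral_congr_fun measurableSet_Ioo hcongr, intervalIntegral.integral_of_le ht.1.le,
    integral_Ioc_eq_integral_Ioo,
    ← setIntegral_congr_fun measurableSet_Ioo (fun r hr => by dsimp only; rw [extendEnds_eq (hsub hr)] :
      EqOn (fun r => dtE T E r (extendEnds T u r)) (fun r => dtE T E r (u r)) (Ioo 0 t))]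
  have hchain := h.chain_rule hE hT ht
  have hneg : ∑' r, (jumpSet T u ∩ Ioo 0 t).indicator
      (fun r => E r (leftVal T u r) - E r (rightVal T u r)) r =
      -jumpSum (jumpSet T u) (Ioo 0 t) fun r => E r (rightVal T u r) - E r (leftVal T u r) := by
    rw [jumpSum, ← tsum_neg]
    refine tsum_congr fun r => ?_
    by_cases hr : r ∈ jumpSet T u ∩ Ioo 0 t <;> simp [hr]
  have hneg' : ∫ r in Ioo 0 t, (-fun r => DE E r (extendEnds T u r) (diffuseDensity T u r)) r
      ∂(refMeasure T u) =
      -∫ r in Ioo 0 t, DE E r (extendEnds T u r) (diffuseDensity T u r) ∂(refMeasure T u) :=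
    integral_neg _
  rw [hneg, hneg']
  linarith

/-- The diffuse and absolutely continuous parts both vanish outside `(0,T)`, hence so does their
difference, the Cantor part. -/
lemma refMeasure_restrict (hf : BoundedVariationOn (extendEnds T u) univ) :
    (refMeasure T u).restrict (Ioo 0 T) = refMeasure T u := by
  refine Measure.restrict_eq_self_of_ae_mem ?_
  have hm : MeasurableSet (Ioo 0 T)ᶜ := measurableSet_Ioo.compl
  rw [ae_iff]
  change refMeasure T u (Ioo 0 T)ᶜ = 0
  have h0 : volume.restrict (Ioo 0 T) (Ioo 0 T)ᶜ = 0 := by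
    rw [Measure.restrict_apply hm, compl_inter_self, measure_empty]
  rw [refMeasure, Measure.add_apply, h0, zero_add, VectorMeasure.variation_apply_eq_zero hm]
  intro s hs hsm
  obtain ⟨D, -, -, hD⟩ := exists_diffusePart_apply hf
  rw [cantorPart, sub_apply, acPart_apply_of_null hsm (measure_mono_null hs h0), hD s hsm,
    (disjoint_compl_left.mono_left hs).inter_eq,
    (disjoint_compl_left.mono_left (inter_subset_left.trans hs)).inter_eq]
  simp

lemma volume_absolutelyContinuous_refMeasure :
    volume.restrict (Ioo 0 T) ≪ refMeasure T u :=
  Measure.absolutelyContinuous_of_le (Measure.le_add_right le_rfl)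

end Curve

/-! ### The characterization of BV solutions -/

section Main

variable [FiniteDimensional ℝ X] {T : ℝ} {u : ℝ → X} {E : ℝ → X → ℝ} {Ψ Ψ₀ : X → ℝ}

/-- The energy balance as an identity between nonnegative quantities. -/
lemma balance_iff {t : ℝ} (ht : 0 < t) :
    ((totalVar Ψ Ψ₀ E T u 0 t : ℝ≥0∞) : EReal) + ((E t (u t) : ℝ) : EReal) =
      ((E 0 (u 0) + ∫ s in (0 : ℝ)..t, dtE T E s (u s) : ℝ) : EReal) ↔
    diffuseVar Ψ₀ T u 0 t + jumpVar Ψ E T u 0 t =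
      ENNReal.ofReal (E 0 (u 0) + (∫ s in (0 : ℝ)..t, dtE T E s (u s)) - E t (u t)) ∧
      E t (u t) ≤ E 0 (u 0) + ∫ s in (0 : ℝ)..t, dtE T E s (u s) := by
  rw [coe_ennreal_add_coe_eq_iff, totalVar, if_pos ht]

/-- Inclusion and jump conditions imply local stability and the energy balance. -/
lemma isBVSolution_of_inclusion (hT : 0 < T) (hΨ₀ : IsGauge Ψ₀) (hΨ : IsViscousPotential Ψ Ψ₀)
    (hE : IsEnergy T E) (hu : BoundedVariationOn u (Icc 0 T))
    (hinc : SatisfiesInclusion Ψ₀ E T u)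
    (hjump : ∀ t ∈ jumpSet T u, DropEqCost Ψ E t (leftVal T u t) (u t) ∧
      DropEqCost Ψ E t (u t) (rightVal T u t)) : IsBVSolution Ψ Ψ₀ E T u := by
  have hf := boundedVariationOn_extendEnds hT.le hu
  simp only [SatisfiesInclusion, hΨ₀.exists_subdiff_iff] at hinc
  -- At continuity points both transitions are constant and cost nothing; this covers the end terms
  -- at `0` and `t` when these are not jump times.
  have hdrop : ∀ t ∈ Icc 0 T, DropEqCost Ψ E t (leftVal T u t) (u t) ∧
      DropEqCost Ψ E t (u t) (rightVal T u t) := by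
    intro t ht
    by_cases htJ : t ∈ jumpSet T u
    · exact hjump t htJ
    · have h := leftVal_eq_of_continuousAt hf (continuousAt_of_notMem_jumpSet hf ht htJ)
      rw [extendEnds_eq ht] at h
      rw [h.1, h.2]
      exact ⟨dropEqCost_self hΨ _, dropEqCost_self hΨ _⟩
  refine ⟨hu, ?_, fun t ht => ?_⟩
  -- Lebesgue measure on `(0,T)` is absolutely continuous with respect to `μ`, so stability
  -- transfers; the endpoints are null.
  · have h1 : ∀ᵐ t ∂(volume.restrict (Ioo 0 T)), -DE E t (u t) ∈ stableSet Ψ₀ :=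
      volume_absolutelyContinuous_refMeasure.ae_le (hinc.mono fun t h => h.1)
    rw [Measure.restrict_congr_set Ioo_ae_eq_Icc] at h1
    exact ae_mono (Measure.restrict_mono sdiff_subset le_rfl) h1
  rcases ht.1.eq_or_lt with rfl | ht0
  · simp [totalVar]
  rw [balance_iff ht0]
  obtain ⟨hi, hsum, hd⟩ := energy_drop hT hE hf ⟨ht0, ht.2⟩
  have hae : ∀ᵐ r ∂((refMeasure T u).restrict (Ioo 0 t)),
      (-DE E r (u r)) (diffuseDensity T u r) = Ψ₀ (diffuseDensity T u r) :=
    (ae_restrict_of_ae hinc).mono fun r h => h.2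
  have hp0 : 0 ≤ᵐ[(refMeasure T u).restrict (Ioo 0 t)]
      fun r => (-DE E r (u r)) (diffuseDensity T u r) := by
    filter_upwards [hae] with r hr
    rw [hr]
    exact hΨ₀.nonneg _
  have hdiff : diffuseVar Ψ₀ T u 0 t = ENNReal.ofReal
      (∫ r in Ioo 0 t, (-DE E r (u r)) (diffuseDensity T u r) ∂(refMeasure T u)) := by
    rw [ofReal_integral_eq_lintegral_ofReal hi hp0, diffuseVar]
    refine lintegral_congr_ae ?_
    filter_upwards [hae] with r hr
    rw [hr]
  obtain ⟨h0, h0'⟩ := dropEqCost_iff.1 (hdrop 0 ⟨le_rfl, hT.le⟩).2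
  obtain ⟨h1, h1'⟩ := dropEqCost_iff.1 (hdrop t ht).1
  have hmem : ∀ r : ↥(jumpSet T u ∩ Ioo 0 t), (r : ℝ) ∈ Icc 0 T := fun r => r.2.1.1
  have hs0 : ∀ r : ↥(jumpSet T u ∩ Ioo 0 t),
      0 ≤ E r (leftVal T u r) - E r (rightVal T u r) := fun r => by
    have h2 := (dropEqCost_iff.1 (hdrop r (hmem r)).1).2
    have h3 := (dropEqCost_iff.1 (hdrop r (hmem r)).2).2
    linarith
  have hjs : ∑' r : ↥(jumpSet T u ∩ Ioo 0 t), (finslerCost Ψ E r (leftVal T u r) (u r) +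
      finslerCost Ψ E r (u r) (rightVal T u r)) = ENNReal.ofReal
      (∑' r : ↥(jumpSet T u ∩ Ioo 0 t), (E r (leftVal T u r) - E r (rightVal T u r))) := by
    rw [ENNReal.ofReal_tsum_of_nonneg hs0 hsum]
    refine tsum_congr fun r => ?_
    obtain ⟨h2, h2'⟩ := dropEqCost_iff.1 (hdrop r (hmem r)).1
    obtain ⟨h3, h3'⟩ := dropEqCost_iff.1 (hdrop r (hmem r)).2
    rw [h2, h3, ← ENNReal.ofReal_add (by linarith) (by linarith)]
    congr 1
    ring
  have hP := integral_nonneg_of_ae hp0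
  have hS : 0 ≤ ∑' r : ↥(jumpSet T u ∩ Ioo 0 t),
    (E r (leftVal T u r) - E r (rightVal T u r)) := tsum_nonneg hs0
  rw [jumpVar, hdiff, hjs, h0, h1, ← ENNReal.ofReal_add (by linarith) (by linarith),
    ← ENNReal.ofReal_add (by linarith) hS, ← ENNReal.ofReal_add hP (by linarith)]
  exact ⟨by congr 1; linarith, by linarith⟩

/-- A BV solution satisfies the differential inclusion and the jump conditions. -/
lemma IsBVSolution.inclusion_and_drop (hT : 0 < T) (hΨ₀ : IsGauge Ψ₀)
    (hΨ : IsViscousPotential Ψ Ψ₀) (hE : IsEnergy T E) (hsol : IsBVSolution Ψ Ψ₀ E T u) :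
    SatisfiesInclusion Ψ₀ E T u ∧ ∀ t ∈ jumpSet T u,
      DropEqCost Ψ E t (leftVal T u t) (u t) ∧ DropEqCost Ψ E t (u t) (rightVal T u t) ∧
      DropEqCost Ψ E t (leftVal T u t) (rightVal T u t) := by
  have hf := boundedVariationOn_extendEnds hT.le hsol.bv
  have hnull : NullSingletonClass (refMeasure T u) := ⟨refMeasure_singleton hf⟩
  have hT0 : (0 : ℝ) ∈ Icc 0 T := ⟨le_rfl, hT.le⟩
  have hTT : T ∈ Icc 0 T := ⟨hT.le, le_rfl⟩
  -- The balance at the final time alone suffices, since it contains every jump and the whole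
  -- diffuse part.
  obtain ⟨hbal, hble⟩ := (balance_iff hT).1 (hsol.balance T hTT)
  obtain ⟨hi, hsum, hd⟩ := energy_drop hT hE hf ⟨hT, le_rfl⟩
  set c : ↥(jumpSet T u ∩ Ioo 0 T) → ℝ≥0∞ := fun r =>
    finslerCost Ψ E r (leftVal T u r) (u r) + finslerCost Ψ E r (u r) (rightVal T u r) with hc
  set k : ↥(jumpSet T u ∩ Ioo 0 T) → ℝ := fun r =>
    E r (leftVal T u r) - E r (rightVal T u r) with hk
  set p : ℝ → ℝ := fun r => (-DE E r (u r)) (diffuseDensity T u r) with hp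
  -- finiteness of the single contributions
  have hfin : diffuseVar Ψ₀ T u 0 T + jumpVar Ψ E T u 0 T ≠ ∞ := by
    rw [hbal]; exact ENNReal.ofReal_ne_top
  obtain ⟨hdfin, hjfin⟩ := ENNReal.add_ne_top.1 hfin
  have hreal := congrArg ENNReal.toReal hbal
  rw [ENNReal.toReal_ofReal (by linarith), ENNReal.toReal_add hdfin hjfin] at hreal
  rw [jumpVar] at hjfin hreal
  obtain ⟨hbfin, hcfin⟩ := ENNReal.add_ne_top.1 hjfin
  obtain ⟨h0fin, hTfin⟩ := ENNReal.add_ne_top.1 hbfin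
  have hcr : ∀ r, c r ≠ ∞ := ENNReal.ne_top_of_tsum_ne_top hcfin
  rw [ENNReal.toReal_add hbfin hcfin, ENNReal.toReal_add h0fin hTfin,
    ENNReal.tsum_toReal_eq hcr] at hreal
  have hcsum : Summable fun r => (c r).toReal := ENNReal.summable_toReal hcfin
  -- lower bounds for the single contributions
  have low : ∀ {t : ℝ} {x y : X}, t ∈ Icc 0 T → finslerCost Ψ E t x y ≠ ∞ →
      E t x - E t y ≤ (finslerCost Ψ E t x y).toReal := fun {t x y} ht hxy =>
    (ENNReal.ofReal_le_iff_le_toReal hxy).1 (ofReal_sub_le_finslerCost hΨ (hE.contDiff_apply ht) x y)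
  have hkc : ∀ r, k r ≤ (c r).toReal := fun r => by
    obtain ⟨h1, h2⟩ := ENNReal.add_ne_top.1 (hcr r)
    simp only [hc, hk]
    rw [ENNReal.toReal_add h1 h2]
    have := low r.2.1.1 h1
    have := low r.2.1.1 h2
    linarith
  -- Stability at every interior continuity point is stability `μ`-a.e., including on the support of
  -- the Cantor part.
  have hae : ∀ᵐ r ∂((refMeasure T u).restrict (Ioo 0 T)), -DE E r (u r) ∈ stableSet Ψ₀ := by
    rw [ae_restrict_iff' measurableSet_Ioo]
    filter_upwards [(countable_jumpSet hf).ae_notMem (refMeasure T u)] with r hr hrT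
    exact stable_of_ae_stable hT hE hf hsol.stable hrT hr
  have hm : AEStronglyMeasurable (fun r => Ψ₀ (diffuseDensity T u r))
      ((refMeasure T u).restrict (Ioo 0 T)) :=
    (hΨ₀.continuous.comp_stronglyMeasurable diffuseDensity_spec.1).aestronglyMeasurable
  have hΨi : IntegrableOn (fun r => Ψ₀ (diffuseDensity T u r)) (Ioo 0 T) (refMeasure T u) :=
    (lintegral_ofReal_ne_top_iff_integrable hm (.of_forall fun r => hΨ₀.nonneg _)).1 hdfin
  have hdv : (diffuseVar Ψ₀ T u 0 T).toReal =
      ∫ r in Ioo 0 T, Ψ₀ (diffuseDensity T u r) ∂(refMeasure T u) :=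
    (integral_eq_lintegral_of_nonneg_ae (.of_forall fun r => hΨ₀.nonneg _) hm).symm
  have hple : ∀ᵐ r ∂((refMeasure T u).restrict (Ioo 0 T)), p r ≤ Ψ₀ (diffuseDensity T u r) :=
    hae.mono fun r hr => hr _
  have hpint := integral_mono_ae hi hΨi hple
  have l0 := low hT0 h0fin
  have lT := low hTT hTfin
  have lS := hsum.tsum_le_tsum hkc hcsum
  rw [hdv] at hreal
  -- all inequalities are equalities
  have eS : ∑' r, (c r).toReal ≤ ∑' r, k r := by linarith
  have e0 : (finslerCost Ψ E 0 (u 0) (rightVal T u 0)).toReal ≤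
    E 0 (u 0) - E 0 (rightVal T u 0) := by linarith
  have eT : (finslerCost Ψ E T (leftVal T u T) (u T)).toReal ≤
    E T (leftVal T u T) - E T (u T) := by linarith
  have eP : ∫ r in Ioo 0 T, (Ψ₀ (diffuseDensity T u r) - p r) ∂(refMeasure T u) = 0 := by
    rw [integral_sub hΨi hi]
    linarith
  refine ⟨?_, fun t ht => ?_⟩
  · simp only [SatisfiesInclusion, hΨ₀.exists_subdiff_iff]
    rw [integral_eq_zero_iff_of_nonneg_ae (hple.mono fun r hr => sub_nonneg.2 hr)
      (hΨi.sub hi)] at eP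
    rw [← refMeasure_restrict hf]
    filter_upwards [hae, eP] with r hr hr'
    exact ⟨hr, (sub_eq_zero.1 hr').symm⟩
  · have htT := ht.1
    -- At `0` and `T` one of the two transitions is constant by the end conventions, and the other
    -- is an end term of the jump variation.
    rcases htT.1.eq_or_lt with rfl | ht0
    · have hl : leftVal T u 0 = u 0 := by rw [leftVal_zero, extendEnds_eq hT0]
      rw [hl]
      have hself := finslerCost_self (E := E) (t := 0) hΨ (u 0)
      exact dropEqCost_of_add_le hΨ (hE.contDiff_apply hT0) (by rwa [hself, zero_add])
        (by rwa [hself, zero_add])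
    · rcases htT.2.eq_or_lt with rfl | htT'
      · have hr : rightVal t u t = u t := by rw [rightVal_end, extendEnds_eq hTT]
        rw [hr]
        have hself := finslerCost_self (E := E) (t := t) hΨ (u t)
        exact dropEqCost_of_add_le hΨ (hE.contDiff_apply hTT) (by rwa [hself, add_zero])
          (by rwa [hself, add_zero])
      · refine dropEqCost_of_add_le hΨ (hE.contDiff_apply htT) (hcr ⟨t, ht, ht0, htT'⟩) ?_
        by_contra hlt
        -- A strict inequality at a single jump would make the sum of costs strictly larger than the
        -- sum of drops.
        exact absurd eS (not_le.2
          (Summable.tsum_lt_tsum (i := ⟨t, ht, ht0, htT'⟩) hkc (not_le.1 hlt) hsum hcsum))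

end Main

end BVRis

end

theorem theorem4p3 {X : Type*} [NormedAddCommGroup X] [NormedSpace ℝ X] [FiniteDimensional ℝ X]
    (T : ℝ) (hT : 0 < T) (Ψ₀ Ψ : X → ℝ) (hΨ₀ : BVRis.IsGauge Ψ₀)
    (hΨ : BVRis.IsViscousPotential Ψ Ψ₀) (E : ℝ → X → ℝ) (hE : BVRis.IsEnergy T E)
    (u : ℝ → X) (hu : BoundedVariationOn u (Set.Icc 0 T)) :
    BVRis.IsBVSolution Ψ Ψ₀ E T u ↔
      BVRis.SatisfiesInclusion Ψ₀ E T u ∧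
      ∀ t ∈ BVRis.jumpSet T u,
        BVRis.DropEqCost Ψ E t (BVRis.leftVal T u t) (u t) ∧
        BVRis.DropEqCost Ψ E t (u t) (BVRis.rightVal T u t) ∧
        BVRis.DropEqCost Ψ E t (BVRis.leftVal T u t) (BVRis.rightVal T u t) := by
  constructor
  · exact fun h => h.inclusion_and_drop hT hΨ₀ hΨ hE
  · exact fun h => BVRis.isBVSolution_of_inclusion hT hΨ₀ hΨ hE hu h.1
      fun t ht => ⟨(h.2 t ht).1, (h.2 t ht).2.1⟩
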